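/- Let $T>0$, let $n,m$ be natural numbers, and write $^{\top}$ for the transpose. Assume: (H1) $A\in L^{1}((0,T);\mathbb{R}^{n\times n})$ and $B\in L^{\infty}((0,T);\mathbb{R}^{n\times m})$; (H2) $M\in C^{1}([0,T]^2;\mathbb{R}^{m\times m})$, and $M(t,s)$ is symmetric positive definite for all $t,s\in[0,T]$; (H3) $Q\in C^{1}([0,T]^2;\mathbb{R}^{n\times n})$ and $G\in C^{1}([0,T];\mathbb{R}^{n\times n})$, and $Q(t,s)$, $G(t)$ are symmetric positive semidefinite for all $t,s\in[0,T]$; (H4) $S\in C^{1}([0,T]^2;\mathbb{R}^{m\times n})$; (H5) for all $0\le t\le s\le T$, the matrices $Q_t(t,s)$, $M_t(t,s)$, $\dot G(t)$, $Q(t,s)-S^{\top}(t,s)M^{-1}(t,s)S(t,s)$ and $Q_t(t,s)-S_t^{\top}(t,s)\,(M_t(t,s))^{-1}S_t(t,s)$ are positive semidefinite; here the subscript $t$ denotes the partial derivative in the first variable, and if $M_t(t,s)$ is singular, $(M_t(t,s))^{-1}S_t(t,s)$ stands for any matrix $K$ with $M_t(t,s)K=S_t(t,s)$, which is then required to exist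 (the product $S_t^{\top}K$ does not depend on its choice). For a symmetric $P\in C([0,T];\mathbb{R}^{n\times n})$ put $\Upsilon(s)=M^{-1}(s,s)\big(B^{\top}(s)P(s)+S(s,s)\big)$, and let $\Phi(t,s)$, $t,s\in[0,T]$, be the state-transition matrix of the linear system $\dot X=(A-B\Upsilon)X$, that is, $\Phi(\cdot,s)$ is the continuous function with $$\Phi(t,s)=I+\int_s^t\big(A(\tau)-B(\tau)\Upsilon(\tau)\big)\Phi(\tau,s)\,d\tau .$$ Put $$\bar Q(t,t)=Q(t,t)-\Phi^{\top}(T,t)\dot G(t)\Phi(T,t)-\int_t^T\Phi^{\top}(s,t)Q_t(t,s)\Phi(s,t)\,ds$$ $$\qquad-\int_t^T\Phi^{\top}(s,t)\Big[\Upsilon^{\top}(s)M_t(t,s)\Upsilon(s)-\Upsilon^{\top}(s)S_t(t,s)-S_t^{\top}(t,s)\Upsilon(s)\Big]\Phi(s,t)\,ds .$$ The function $P$ is called a solution of the equilibrium Riccati equation if, for all $t\in[0,T]$, $$P(t)=G(T)+\int_t^T\Big(A^{\top}(s)P(s)+P(s)A(s)+\bar Q(s,s)-\big[P(s)B(s)+S^{\top}(s,s)\big]M^{-1}(s,s)\big[B^{\top}(s)P(s)+S(s,s)\big]\Big)ds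 .$$ Then the equilibrium Riccati equation has exactly one symmetric solution $P\in C([0,T];\mathbb{R}^{n\times n})$. Moreover, $P(t)$ is positive semidefinite for every $t\in[0,T]$. -/

import Mathlib

open MeasureTheory

noncomputable section

namespace EqRiccati

/-- Matrix-valued functions whose entries are in `L¹(0,T)`. -/
def IsL1 (T : ℝ) {p q : ℕ} (F : ℝ → Matrix (Fin p) (Fin q) ℝ) : Prop :=
  ∀ i j, MemLp (fun t => F t i j) 1 (volume.restrict (Set.Icc 0 T))

/-- Matrix-valued functions whose entries are in `L^∞(0,T)`. -/
def IsLinfty (T : ℝ) {p q : ℕ} (F : ℝ → Matrix (Fin p) (Fin q) ℝ) : Prop :=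
  ∀ i j, MemLp (fun t => F t i j) ⊤ (volume.restrict (Set.Icc 0 T))

/-- Matrix-valued functions of class `C¹` on `[0,T]` (one-sided at the end points). -/
def IsC1 (T : ℝ) {p q : ℕ} (F : ℝ → Matrix (Fin p) (Fin q) ℝ) : Prop :=
  ∀ i j, ContDiffOn ℝ 1 (fun t => F t i j) (Set.Icc 0 T)

/-- Matrix-valued functions of class `C¹` on the closed square `[0,T] × [0,T]`. -/
def IsC1Sq (T : ℝ) {p q : ℕ} (F : ℝ → ℝ → Matrix (Fin p) (Fin q) ℝ) : Prop :=
  ∀ i j, ContDiffOn ℝ 1 (fun z : ℝ × ℝ => F z.1 z.2 i j) (Set.Icc 0 T ×ˢ Set.Icc 0 T)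

/-- The entrywise derivative of a matrix-valued function on `[0,T]`. -/
def dot (T : ℝ) {p q : ℕ} (F : ℝ → Matrix (Fin p) (Fin q) ℝ) (t : ℝ) :
    Matrix (Fin p) (Fin q) ℝ :=
  Matrix.of fun i j => derivWithin (fun r => F r i j) (Set.Icc 0 T) t

/-- The entrywise partial derivative `F_t(t,s)` with respect to the first variable. -/
def dfst (T : ℝ) {p q : ℕ} (F : ℝ → ℝ → Matrix (Fin p) (Fin q) ℝ) (t s : ℝ) :
    Matrix (Fin p) (Fin q) ℝ :=
  dot T (fun r => F r s) t

/-- The entrywise integral `∫_a^b F(s) ds`. -/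
def matInt {p q : ℕ} (a b : ℝ) (F : ℝ → Matrix (Fin p) (Fin q) ℝ) :
    Matrix (Fin p) (Fin q) ℝ :=
  Matrix.of fun i j => ∫ s in a..b, F s i j

/-- `Φ` is the state-transition matrix on `[0,T]` of the linear system `X' = a X`:
`∂Φ(t,s)/∂t = a(t) Φ(t,s)`, `Φ(s,s) = I`, in integrated (Carathéodory) form. -/
def IsTransition (T : ℝ) {n : ℕ} (a : ℝ → Matrix (Fin n) (Fin n) ℝ)
    (Φ : ℝ → ℝ → Matrix (Fin n) (Fin n) ℝ) : Prop :=
  ∀ s ∈ Set.Icc 0 T, ContinuousOn (fun t => Φ t s) (Set.Icc 0 T) ∧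
    ∀ t ∈ Set.Icc 0 T, Φ t s = 1 + matInt s t (fun τ => a τ * Φ τ s)

/-- The coefficients of the control problem. -/
structure Coeffs (n m : ℕ) where
  A : ℝ → Matrix (Fin n) (Fin n) ℝ
  B : ℝ → Matrix (Fin n) (Fin m) ℝ
  M : ℝ → ℝ → Matrix (Fin m) (Fin m) ℝ
  Q : ℝ → ℝ → Matrix (Fin n) (Fin n) ℝ
  S : ℝ → ℝ → Matrix (Fin m) (Fin n) ℝ
  G : ℝ → Matrix (Fin n) (Fin n) ℝ

variable {n m : ℕ}

/-- (H1) -/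
structure H1 (T : ℝ) (c : Coeffs n m) : Prop where
  A_mem : IsL1 T c.A
  B_mem : IsLinfty T c.B

/-- (H2); `Matrix.PosDef` includes symmetry. -/
structure H2 (T : ℝ) (c : Coeffs n m) : Prop where
  M_C1 : IsC1Sq T c.M
  M_pos : ∀ t ∈ Set.Icc 0 T, ∀ s ∈ Set.Icc 0 T, (c.M t s).PosDef

/-- (H3); `Matrix.PosSemidef` includes symmetry. -/
structure H3 (T : ℝ) (c : Coeffs n m) : Prop where
  Q_C1 : IsC1Sq T c.Q
  Q_nonneg : ∀ t ∈ Set.Icc 0 T, ∀ s ∈ Set.Icc 0 T, (c.Q t s).PosSemidef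
  G_C1 : IsC1 T c.G
  G_nonneg : ∀ t ∈ Set.Icc 0 T, (c.G t).PosSemidef

/-- (H4) -/
structure H4 (T : ℝ) (c : Coeffs n m) : Prop where
  S_C1 : IsC1Sq T c.S

/-- (H5). In the last item `K` stands for `M_t⁻¹ S_t`. If `M_t(t,s)` is invertible, then `K` is
forced to be `M_t⁻¹ S_t` and the item says that `Q_t - S_tᵀ M_t⁻¹ S_t` is positive semidefinite.
If `M_t(t,s)` is singular, then `S_tᵀ K` does not depend on the choice of `K`, and the case
`M_t = 0`, `S_t = 0` is covered with `K = 0`. -/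
structure H5 (T : ℝ) (c : Coeffs n m) : Prop where
  Qt_nonneg : ∀ t s : ℝ, 0 ≤ t → t ≤ s → s ≤ T → (dfst T c.Q t s).PosSemidef
  Mt_nonneg : ∀ t s : ℝ, 0 ≤ t → t ≤ s → s ≤ T → (dfst T c.M t s).PosSemidef
  G_dot_nonneg : ∀ t ∈ Set.Icc 0 T, (dot T c.G t).PosSemidef
  schur_nonneg : ∀ t s : ℝ, 0 ≤ t → t ≤ s → s ≤ T →
    (c.Q t s - (c.S t s).transpose * (c.M t s)⁻¹ * c.S t s).PosSemidef
  schur_t_nonneg : ∀ t s : ℝ, 0 ≤ t → t ≤ s → s ≤ T →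
    ∃ K : Matrix (Fin m) (Fin n) ℝ, dfst T c.M t s * K = dfst T c.S t s ∧
      (dfst T c.Q t s - (dfst T c.S t s).transpose * K).PosSemidef

/-- `Υ(s) = M(s,s)⁻¹ (B(s)ᵀ P(s) + S(s,s))`. -/
def Coeffs.Upsilon (c : Coeffs n m) (P : ℝ → Matrix (Fin n) (Fin n) ℝ) (s : ℝ) :
    Matrix (Fin m) (Fin n) ℝ :=
  (c.M s s)⁻¹ * ((c.B s).transpose * P s + c.S s s)

/-- The closed-loop matrix `A(τ) - B(τ) Υ(τ)`. -/
def Coeffs.closedLoop (c : Coeffs n m) (P : ℝ → Matrix (Fin n) (Fin n) ℝ) (τ : ℝ) :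
    Matrix (Fin n) (Fin n) ℝ :=
  c.A τ - c.B τ * c.Upsilon P τ

/-- The nonlocal term `Q̄(t,t)`, for given `P` and `Φ`. -/
def Coeffs.Qbar (c : Coeffs n m) (T : ℝ) (P : ℝ → Matrix (Fin n) (Fin n) ℝ)
    (Φ : ℝ → ℝ → Matrix (Fin n) (Fin n) ℝ) (t : ℝ) : Matrix (Fin n) (Fin n) ℝ :=
  c.Q t t
    - (Φ T t).transpose * dot T c.G t * Φ T t
    - matInt t T (fun s => (Φ s t).transpose * dfst T c.Q t s * Φ s t)
    - matInt t T (fun s => (Φ s t).transpose *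
        ((c.Upsilon P s).transpose * dfst T c.M t s * c.Upsilon P s
          - (c.Upsilon P s).transpose * dfst T c.S t s
          - (dfst T c.S t s).transpose * c.Upsilon P s) * Φ s t)

/-- `P` is a symmetric continuous solution on `[0,T]` of the equilibrium Riccati equation, in
integrated form. Here `Φ` is the state-transition matrix of the closed-loop system of `P`. -/
structure IsRiccatiSolution (T : ℝ) (c : Coeffs n m)
    (P : ℝ → Matrix (Fin n) (Fin n) ℝ) : Prop where
  cont : ContinuousOn P (Set.Icc 0 T)
  symm : ∀ t ∈ Set.Icc 0 T, (P t).IsSymm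
  eqn : ∃ Φ : ℝ → ℝ → Matrix (Fin n) (Fin n) ℝ, IsTransition T (c.closedLoop P) Φ ∧
    ∀ t ∈ Set.Icc 0 T, P t = c.G T + matInt t T (fun s =>
      (c.A s).transpose * P s + P s * c.A s + c.Qbar T P Φ s
        - (P s * c.B s + (c.S s s).transpose) * (c.M s s)⁻¹
          * ((c.B s).transpose * P s + c.S s s))

end EqRiccati

end

open MeasureTheory

noncomputable section

namespace EqRiccati

open Set
open scoped Matrix

/-! The nonlocal Riccati equation is a fixed-point equation in disguise. Write `X` for the
closed-loop fundamental matrix with `X(T) = 1`, `Y` for its inverse (so `Φ(s,t) = X(s) Y(t)`), `V =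
(1; -Υ)` for the output and `K` for the block kernel with blocks `Q, Sᵀ, S, M`. The cost-to-go under
the feedback of `P`, `value(t) = Φ(T,t)ᵀ G(t) Φ(T,t) + ∫_t^T Φ(s,t)ᵀ V(s)ᵀ K(t,s) V(s) Φ(s,t) ds`,
solves a linear Lyapunov equation. The dependence of `G` and `K` on the evaluation time `t`
contributes the same expression with `Ġ` and `K_t`, called `drift`, which is exactly the correction
in `Q̄` (`Qbar_eq`). After completion of the square, `P` solves the Riccati equation iff `P =
value(P)`: both functions solve one linear Lyapunov equation with terminal value `G(T)`
(`isRiccatiSolution_of_eq_value`, `eq_value_of_isRiccatiSolution`).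

The map `P ↦ value(P)` is causal, and Lipschitz on bounded sets: the difference of values at `t` is
at most `C ∫_t^T ‖P - P'‖` (`exists_value_lipschitz`). Backward Gronwall then gives uniqueness. For
existence, `P` is truncated radially at radius `R` inside `value`; the resulting map is globally
Lipschitz and has a fixed point by contraction in a Bielecki norm.

It remains to choose `R` so that the truncation is inactive (`exists_apriori_bound`). A truncated
fixed point satisfies `P = value(ρP)` with `0 ≤ ρ ≤ 1`. By (H5) the kernels `K` and `K_t` are
positive semidefinite for `t ≤ s`, so `P ≥ 0` and `drift ≥ 0`. In the equation for `tr P` the drift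
and the term quadratic in `P` have the favourable sign, whatever `ρ` is (`trace_closedLoop_le`), so
`tr P`, which dominates `‖P‖`, obeys a linear Gronwall inequality independent of `R`. -/

open scoped MatrixOrder in
lemma exists_eq_transpose_mul_self {p : Type*} [Fintype p] {A : Matrix p p ℝ}
    (hA : A.PosSemidef) : ∃ C : Matrix p p ℝ, A = Cᵀ * C := by
  classical
  obtain ⟨C, rfl⟩ := CStarAlgebra.nonneg_iff_eq_star_mul_self.1 (Matrix.nonneg_iff_posSemidef.2 hA)
  exact ⟨C, by rw [Matrix.star_eq_conjTranspose, Matrix.conjTranspose_eq_transpose_of_trivial]⟩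

/-! ### Backward Volterra inequalities -/

lemma intervalIntegrable_sub {E : Type*} [NormedAddCommGroup E] {f : ℝ → E} {a b s t : ℝ}
    (hf : IntegrableOn f (Icc a b)) (hs : s ∈ Icc a b) (ht : t ∈ Icc a b) :
    IntervalIntegrable f volume s t :=
  (intervalIntegrable_iff.2 (hf.mono_set (uIoc_subset_uIcc.trans (uIcc_subset_Icc hs ht))))

lemma continuousOn_tail {E : Type*} [NormedAddCommGroup E] [NormedSpace ℝ E] {f : ℝ → E}
    {a b : ℝ} (hf : IntegrableOn f (Icc a b)) :
    ContinuousOn (fun t => ∫ s in t..b, f s) (Icc a b) := by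
  rcases le_or_gt a b with hab | hab
  · have h := (intervalIntegral.continuousOn_primitive_interval (μ := volume) (f := f) (a := a)
      (b := b) (by rwa [uIcc_of_le hab]))
    rw [uIcc_of_le hab] at h
    refine ((continuousOn_const (c := ∫ s in a..b, f s)).sub h).congr fun t ht => ?_
    have ha : a ∈ Icc a b := left_mem_Icc.2 hab
    have hb : b ∈ Icc a b := right_mem_Icc.2 hab
    exact (intervalIntegral.integral_interval_sub_left (intervalIntegrable_sub hf ha hb)
      (intervalIntegrable_sub hf ha ht)).symm
  · simp [Icc_eq_empty_of_lt hab]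

lemma tail_add {E : Type*} [NormedAddCommGroup E] [NormedSpace ℝ E] {f : ℝ → E} {a b s t : ℝ}
    (hf : IntegrableOn f (Icc a b)) (hs : s ∈ Icc a b) (ht : t ∈ Icc a b) :
    ∫ r in s..b, f r = (∫ r in s..t, f r) + ∫ r in t..b, f r :=
  (intervalIntegral.integral_add_adjacent_intervals (intervalIntegrable_sub hf hs ht)
    (intervalIntegrable_sub hf ht (right_mem_Icc.2 (hs.1.trans hs.2)))).symm

lemma tail_nonneg {k : ℝ → ℝ} (hk0 : ∀ s, 0 ≤ k s) {b t : ℝ} (ht : t ≤ b) :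
    0 ≤ ∫ s in t..b, k s :=
  intervalIntegral.integral_nonneg ht fun s _ => hk0 s

lemma tail_antitone {k : ℝ → ℝ} {a b s t : ℝ} (hk : IntegrableOn k (Icc a b))
    (hk0 : ∀ s, 0 ≤ k s) (hs : s ∈ Icc a b) (ht : t ∈ Icc a b) (hst : s ≤ t) :
    ∫ r in t..b, k r ≤ ∫ r in s..b, k r := by
  rw [tail_add hk hs ht]
  have := tail_nonneg hk0 hst
  linarith

lemma integrableOn_mul_continuousOn {k w : ℝ → ℝ} {a b : ℝ} (hk : IntegrableOn k (Icc a b))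
    (hw : ContinuousOn w (Icc a b)) : IntegrableOn (fun s => k s * w s) (Icc a b) :=
  hk.mul_continuousOn hw isCompact_Icc

/-- The weighted kernel estimate behind Bielecki norms. -/
lemma integral_kernel_mul_exp_le {k : ℝ → ℝ} {a b t : ℝ} (hk : IntegrableOn k (Icc a b))
    (hk0 : ∀ s, 0 ≤ k s) (ht : t ∈ Icc a b) :
    ∫ s in t..b, k s * Real.exp (2 * ∫ r in s..b, k r)
      ≤ Real.exp (2 * ∫ r in t..b, k r) / 2 := by
  set f : ℝ → ℝ := fun x => -(Real.exp (2 * ∫ r in x..b, k r) / 2) with hf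
  have hsub : Icc t b ⊆ Icc a b := Icc_subset_Icc_left ht.1
  have hkt : IntegrableOn k (Icc t b) := hk.mono_set hsub
  have hmono : MonotoneOn f (uIcc t b) := by
    rw [uIcc_of_le ht.2]
    intro x hx y hy hxy
    have := tail_antitone hkt hk0 hx hy hxy
    simp only [hf]
    gcongr
  -- For a monotone function the integral of the derivative is at most the increment, so an a.e.
  -- derivative of `f` suffices and absolute continuity of `f` is not needed.
  have hmem := hmono.intervalIntegral_deriv_mem_uIcc
  have hii : IntervalIntegrable k volume t b :=
    intervalIntegrable_sub hkt (left_mem_Icc.2 ht.2) (right_mem_Icc.2 ht.2)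
  have hder : ∀ᵐ x, x ∈ uIcc t b → deriv f x = k x * Real.exp (2 * ∫ r in x..b, k r) := by
    filter_upwards [hii.ae_hasDerivAt_integral] with x hx hxm
    have h1 := hx hxm b right_mem_uIcc
    have h2 : HasDerivAt (fun x => ∫ r in x..b, k r) (-k x) x := by
      have := h1.neg
      refine this.congr_of_eventuallyEq (Filter.Eventually.of_forall fun y => ?_)
      simp [intervalIntegral.integral_symm y b]
    have h3 := (((h2.const_mul 2).exp).div_const 2).neg
    refine h3.deriv.trans ?_
    ring
  have heq : ∫ x in t..b, deriv f x = ∫ s in t..b, k s * Real.exp (2 * ∫ r in s..b, k r) := by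
    apply intervalIntegral.integral_congr_ae
    filter_upwards [hder] with x hx hxm using hx (uIoc_subset_uIcc hxm)
  have hle : f t ≤ f b := hmono left_mem_uIcc right_mem_uIcc ht.2
  rw [heq, uIcc_of_le (sub_nonneg.2 hle)] at hmem
  refine hmem.2.trans ?_
  simp only [hf, intervalIntegral.integral_same, mul_zero, Real.exp_zero]
  linarith

/-- Backward Gronwall inequality with an integrable kernel. -/
lemma gronwall_backward {k w : ℝ → ℝ} {a b c : ℝ} (hk : IntegrableOn k (Icc a b))
    (hk0 : ∀ s, 0 ≤ k s) (hw : ContinuousOn w (Icc a b)) (hc : 0 ≤ c)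
    (h : ∀ t ∈ Icc a b, w t ≤ c + ∫ s in t..b, k s * w s) {t : ℝ} (ht : t ∈ Icc a b) :
    w t ≤ 2 * c * Real.exp (2 * ∫ r in t..b, k r) := by
  set e : ℝ → ℝ := fun t => Real.exp (2 * ∫ r in t..b, k r) with he
  have hec : ContinuousOn e (Icc a b) :=
    (continuousOn_const.mul (continuousOn_tail hk)).rexp
  have hepos : ∀ t, 0 < e t := fun t => Real.exp_pos _
  have he1 : ∀ t ∈ Icc a b, 1 ≤ e t := fun t ht =>
    Real.one_le_exp (mul_nonneg zero_le_two (tail_nonneg hk0 ht.2))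
  -- At a maximum point of `w / e`, the weighted kernel estimate gives `W e(x) ≤ c + W e(x) / 2`;
  -- with `e ≥ 1` this forces `W ≤ 2c`. This is the origin of the factor 2.
  obtain ⟨x, hx, hmax⟩ := isCompact_Icc.exists_isMaxOn ⟨t, ht⟩
    (hw.div hec fun t _ => (hepos t).ne')
  set W := w x / e x with hW
  have hwW : ∀ s ∈ Icc a b, w s ≤ W * e s := fun s hs =>
    (div_le_iff₀ (hepos s)).1 (hmax hs)
  suffices hW2 : W ≤ 2 * c from
    (hwW t ht).trans (mul_le_mul_of_nonneg_right hW2 (hepos t).le)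
  by_contra! hcon
  have hWpos : 0 < W := lt_of_le_of_lt (by positivity) hcon
  have hb : b ∈ Icc a b := right_mem_Icc.2 (hx.1.trans hx.2)
  have h1 : w x ≤ c + W * (e x / 2) := by
    refine (h x hx).trans (add_le_add_right ?_ c)
    calc ∫ s in x..b, k s * w s ≤ ∫ s in x..b, W * (k s * e s) := by
          refine intervalIntegral.integral_mono_on hx.2
            (intervalIntegrable_sub (integrableOn_mul_continuousOn hk hw) hx hb)
            ((intervalIntegrable_sub (integrableOn_mul_continuousOn hk hec) hx hb).const_mul W) ?_
          intro s hs
          have hs' : s ∈ Icc a b := ⟨hx.1.trans hs.1, hs.2⟩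
          nlinarith [hwW s hs', hk0 s]
      _ = W * ∫ s in x..b, k s * e s := intervalIntegral.integral_const_mul _ _
      _ ≤ W * (e x / 2) :=
          mul_le_mul_of_nonneg_left (integral_kernel_mul_exp_le hk hk0 hx) hWpos.le
  have h2 : w x = W * e x := by rw [hW, div_mul_cancel₀ _ (hepos x).ne']
  have h3 := he1 x hx
  nlinarith

/-- A causal (backward) Volterra operator has a fixed point. -/
lemma exists_fixedPoint_backward {E : Type*} [NormedAddCommGroup E] [CompleteSpace E]
    [NormedSpace ℝ E] {k : ℝ → ℝ} {a b : ℝ} (hab : a ≤ b) (hk : IntegrableOn k (Icc a b))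
    (hk0 : ∀ s, 0 ≤ k s) (Γ : (ℝ → E) → ℝ → E)
    (hcont : ∀ u, ContinuousOn u (Icc a b) → ContinuousOn (Γ u) (Icc a b))
    (hlip : ∀ u v, ContinuousOn u (Icc a b) → ContinuousOn v (Icc a b) → ∀ t ∈ Icc a b,
      ‖Γ u t - Γ v t‖ ≤ ∫ s in t..b, k s * ‖u s - v s‖) :
    ∃ u, ContinuousOn u (Icc a b) ∧ ∀ t ∈ Icc a b, u t = Γ u t := by
  set e : ℝ → ℝ := fun t => Real.exp (2 * ∫ r in t..b, k r) with he
  have hec : ContinuousOn e (Icc a b) :=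
    (continuousOn_const.mul (continuousOn_tail hk)).rexp
  have hepos : ∀ t, 0 < e t := fun t => Real.exp_pos _
  -- Conjugation by the weight `e` turns the Bielecki norm into the sup norm; the kernel estimate
  -- then makes the conjugated map `Λ` a contraction with constant 1/2.
  let ext : C(Icc a b, E) → ℝ → E := fun v t => e t • v (projIcc a b hab t)
  have hext : ∀ v, ContinuousOn (ext v) (Icc a b) := fun v =>
    hec.smul (v.continuous.comp continuous_projIcc).continuousOn
  let Λ : C(Icc a b, E) → C(Icc a b, E) := fun v =>
    ⟨fun t => (e t)⁻¹ • Γ (ext v) t, by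
      have h1 := (hec.inv₀ fun t _ => (hepos t).ne').smul (hcont _ (hext v))
      exact continuousOn_iff_continuous_domRestrict.1 h1⟩
  have hcontr : ContractingWith (1 / 2 : NNReal) Λ := by
    refine ⟨by rw [div_lt_one] <;> norm_num, LipschitzWith.of_dist_le_mul fun u v => ?_⟩
    rw [ContinuousMap.dist_le (by positivity)]
    intro t
    have hd : ∀ s, ‖ext u s - ext v s‖ ≤ e s * dist u v := fun s => by
      simp only [ext, ← smul_sub, norm_smul, Real.norm_of_nonneg (hepos s).le]
      rw [← dist_eq_norm]
      exact mul_le_mul_of_nonneg_left (ContinuousMap.dist_apply_le_dist _) (hepos s).le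
    have hb : b ∈ Icc a b := right_mem_Icc.2 hab
    have h1 : ‖Γ (ext u) t - Γ (ext v) t‖ ≤ (e t / 2) * dist u v := by
      refine (hlip _ _ (hext u) (hext v) t t.2).trans ?_
      calc ∫ s in (t : ℝ)..b, k s * ‖ext u s - ext v s‖
          ≤ ∫ s in (t : ℝ)..b, (k s * e s) * dist u v := by
            refine intervalIntegral.integral_mono_on t.2.2
              (intervalIntegrable_sub (integrableOn_mul_continuousOn hk
                ((hext u).sub (hext v)).norm) t.2 hb)
              ((intervalIntegrable_sub (integrableOn_mul_continuousOn hk hec) t.2 hb).mul_const _)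
              fun s _ => ?_
            rw [mul_assoc]
            exact mul_le_mul_of_nonneg_left (hd s) (hk0 s)
        _ = (∫ s in (t : ℝ)..b, k s * e s) * dist u v :=
            intervalIntegral.integral_mul_const _ _
        _ ≤ (e t / 2) * dist u v :=
            mul_le_mul_of_nonneg_right (integral_kernel_mul_exp_le hk hk0 t.2) dist_nonneg
    change dist ((e t)⁻¹ • Γ (ext u) t) ((e t)⁻¹ • Γ (ext v) t) ≤ _
    rw [dist_eq_norm, ← smul_sub, norm_smul, norm_inv, Real.norm_of_nonneg (hepos t).le,
      inv_mul_le_iff₀ (hepos t)]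
    refine h1.trans (le_of_eq ?_)
    push_cast
    ring
  obtain ⟨v, hv, -⟩ := hcontr.exists_fixedPoint 0 (edist_ne_top _ _)
  refine ⟨ext v, hext v, fun t ht => ?_⟩
  have h1 : (e t)⁻¹ • Γ (ext v) t = v ⟨t, ht⟩ := DFunLike.congr_fun hv ⟨t, ht⟩
  simp only [ext, projIcc_of_mem hab ht]
  rw [← h1, smul_smul, mul_inv_cancel₀ (hepos t).ne', one_smul]

open scoped Matrix.Norms.Frobenius

/-! ### Matrix-valued functions -/

-- Uniformity and topology on matrices are taken from the Frobenius norm, so that continuity,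
-- integrability and completeness all refer to the same submultiplicative, transpose-invariant norm.
scoped instance (priority := 2000) frobeniusUniformSpace {p q : Type*} [Fintype p] [Fintype q] :
    UniformSpace (Matrix p q ℝ) := PseudoMetricSpace.toUniformSpace

scoped instance (priority := 2000) frobeniusTopologicalSpace {p q : Type*} [Fintype p]
    [Fintype q] : TopologicalSpace (Matrix p q ℝ) :=
  PseudoMetricSpace.toUniformSpace.toTopologicalSpace

scoped instance frobeniusCompleteSpace {p q : Type*} [Fintype p] [Fintype q] :
    CompleteSpace (Matrix p q ℝ) := FiniteDimensional.complete ℝ _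

section Matrices

variable {p q r : Type*} [Fintype p] [Fintype q] [Fintype r]

/-- The entry of a matrix, as a continuous linear functional. -/
def entryCLM (i : p) (j : q) : Matrix p q ℝ →L[ℝ] ℝ :=
  (Matrix.entryLinearMap ℝ ℝ i j).toContinuousLinearMap

@[simp] lemma entryCLM_apply (i : p) (j : q) (F : Matrix p q ℝ) : entryCLM i j F = F i j := rfl

/-- Transposition, as a continuous linear map. -/
def transposeCLM : Matrix p q ℝ →L[ℝ] Matrix q p ℝ :=
  (Matrix.transposeLinearEquiv p q ℝ ℝ).toLinearMap.toContinuousLinearMap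

@[simp] lemma transposeCLM_apply (F : Matrix p q ℝ) : transposeCLM F = Fᵀ := rfl

/-- The trace, as a continuous linear functional. -/
def traceCLM : Matrix p p ℝ →L[ℝ] ℝ := (Matrix.traceLinearMap p ℝ ℝ).toContinuousLinearMap

@[simp] lemma traceCLM_apply (F : Matrix p p ℝ) : traceCLM F = F.trace := rfl

/-- Two-sided multiplication by fixed matrices, as a continuous linear map. -/
def sandwichCLM {u : Type*} [Fintype u] (L : Matrix p q ℝ) (R : Matrix r u ℝ) :
    Matrix q r ℝ →L[ℝ] Matrix p u ℝ :=
  LinearMap.toContinuousLinearMap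
    { toFun := fun F => L * F * R
      map_add' := fun F G => by rw [Matrix.mul_add, Matrix.add_mul]
      map_smul' := fun c F => by simp }

@[simp] lemma sandwichCLM_apply {u : Type*} [Fintype u] (L : Matrix p q ℝ) (R : Matrix r u ℝ)
    (F : Matrix q r ℝ) : sandwichCLM L R F = L * F * R := rfl

lemma continuousOn_matrix {α : Type*} [TopologicalSpace α] {F : α → Matrix p q ℝ} {s : Set α} :
    ContinuousOn F s ↔ ∀ i j, ContinuousOn (fun x => F x i j) s :=
  ⟨fun h i j => (entryCLM i j).continuous.comp_continuousOn h,
    fun h => continuousOn_pi.2 fun i => continuousOn_pi.2 fun j => h i j⟩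

lemma continuous_matrix_mul :
    Continuous (fun x : Matrix p q ℝ × Matrix q r ℝ => x.1 * x.2) :=
  Continuous.matrix_mul continuous_fst continuous_snd

lemma _root_.ContinuousOn.mmul {α : Type*} [TopologicalSpace α] {F : α → Matrix p q ℝ}
    {G : α → Matrix q r ℝ} {s : Set α} (hF : ContinuousOn F s) (hG : ContinuousOn G s) :
    ContinuousOn (fun x => F x * G x) s :=
  continuous_matrix_mul.comp_continuousOn (hF.prodMk hG)

lemma _root_.ContinuousOn.mtranspose {α : Type*} [TopologicalSpace α] {F : α → Matrix p q ℝ}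
    {s : Set α} (hF : ContinuousOn F s) : ContinuousOn (fun x => (F x)ᵀ) s :=
  transposeCLM.continuous.comp_continuousOn hF

variable {α : Type*} [MeasurableSpace α] {μ : Measure α}

/-- Links the entrywise hypotheses to norm estimates: a matrix is a finite sum of its entries times
matrix units. -/
lemma memLp_matrix {P : ENNReal} {F : α → Matrix p q ℝ} :
    MemLp F P μ ↔ ∀ i j, MemLp (fun x => F x i j) P μ := by
  classical
  refine ⟨fun h i j => (entryCLM i j).comp_memLp' h, fun h => ?_⟩
  have hsum : MemLp (fun x => ∑ i, ∑ j, F x i j • Matrix.single i j (1 : ℝ)) P μ :=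
    memLp_finsetSum _ fun i _ => memLp_finsetSum _ fun j _ =>
      (ContinuousLinearMap.toSpanSingleton ℝ (Matrix.single i j (1 : ℝ))).comp_memLp' (h i j)
  convert hsum using 2 with x
  conv_lhs => rw [Matrix.matrix_eq_sum_single (F x)]
  simp

lemma _root_.MeasureTheory.MemLp.mmul {P Q R : ENNReal} [ENNReal.HolderTriple P Q R]
    {F : α → Matrix p q ℝ} {G : α → Matrix q r ℝ} (hF : MemLp F P μ) (hG : MemLp G Q μ) :
    MemLp (fun x => F x * G x) R μ := by
  refine MemLp.of_bilin (fun A B => A * B) 1 hF hG ?_ ?_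
  · exact continuous_matrix_mul.comp_aestronglyMeasurable
      (hF.aestronglyMeasurable.prodMk hG.aestronglyMeasurable)
  · exact Filter.Eventually.of_forall fun x => by
      simpa using Matrix.frobenius_nnnorm_mul (F x) (G x)

lemma _root_.MeasureTheory.MemLp.mtranspose {P : ENNReal} {F : α → Matrix p q ℝ}
    (hF : MemLp F P μ) : MemLp (fun x => (F x)ᵀ) P μ :=
  (transposeCLM (p := p) (q := q)).comp_memLp' hF

lemma memLp_top_bound {E : Type*} [NormedAddCommGroup E] {F : α → E} (hF : MemLp F ⊤ μ) :
    ∃ C, 0 ≤ C ∧ ∀ᵐ x ∂μ, ‖F x‖ ≤ C := by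
  refine ⟨(eLpNorm F ⊤ μ).toReal, ENNReal.toReal_nonneg, ?_⟩
  have h := ae_le_eLpNormEssSup (f := F) (μ := μ)
  filter_upwards [h] with x hx
  rw [eLpNorm_exponent_top]
  have hfin : eLpNormEssSup F μ ≠ ⊤ := by
    have := hF.2.ne
    rwa [eLpNorm_exponent_top] at this
  simpa using (ENNReal.toReal_mono hfin hx)

lemma memLp_top_of_continuousOn {β E : Type*} [TopologicalSpace β] [MeasurableSpace β]
    [OpensMeasurableSpace β] [SecondCountableTopology β] [T2Space β]
    {ν : Measure β} [NormedAddCommGroup E] {F : β → E} {s : Set β} (hs : IsCompact s)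
    (hF : ContinuousOn F s) : MemLp F ⊤ (ν.restrict s) := by
  obtain ⟨C, hC⟩ := hs.exists_bound_of_continuousOn hF
  refine memLp_top_of_bound (hF.aestronglyMeasurable hs.measurableSet) C ?_
  exact (ae_restrict_iff' hs.measurableSet).2 (Filter.Eventually.of_forall hC)

end Matrices

/-- `F` is a primitive of `f` on `[a,b]`, normalised at the right end point. -/
structure IsPrimitive {E : Type*} [NormedAddCommGroup E] [NormedSpace ℝ E] (a b : ℝ)
    (F f : ℝ → E) : Prop where
  integrable : IntegrableOn f (Icc a b)
  eq : ∀ t ∈ Icc a b, F t = F b - ∫ s in t..b, f s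

/-! ### Calculus of primitives: linearity and the product rule. -/

namespace IsPrimitive

variable {E E' : Type*} [NormedAddCommGroup E] [NormedSpace ℝ E] [NormedAddCommGroup E']
  [NormedSpace ℝ E'] {a b : ℝ} {F f G g : ℝ → E}

lemma continuousOn (h : IsPrimitive a b F f) : ContinuousOn F (Icc a b) :=
  (continuousOn_const.sub (continuousOn_tail h.integrable)).congr h.eq

lemma clm [CompleteSpace E] [CompleteSpace E'] (h : IsPrimitive a b F f) (L : E →L[ℝ] E') :
    IsPrimitive a b (fun t => L (F t)) (fun t => L (f t)) where
  integrable := L.integrable_comp h.integrable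
  eq t ht := by
    rw [h.eq t ht, map_sub, L.intervalIntegral_comp_comm
      (intervalIntegrable_sub h.integrable ht (right_mem_Icc.2 (ht.1.trans ht.2)))]

lemma add (hF : IsPrimitive a b F f) (hG : IsPrimitive a b G g) :
    IsPrimitive a b (fun t => F t + G t) (fun t => f t + g t) where
  integrable := hF.integrable.add hG.integrable
  eq t ht := by
    have hb : b ∈ Icc a b := right_mem_Icc.2 (ht.1.trans ht.2)
    rw [intervalIntegral.integral_add (intervalIntegrable_sub hF.integrable ht hb)
      (intervalIntegrable_sub hG.integrable ht hb), hF.eq t ht, hG.eq t ht]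
    abel

lemma sub (hF : IsPrimitive a b F f) (hG : IsPrimitive a b G g) :
    IsPrimitive a b (fun t => F t - G t) (fun t => f t - g t) where
  integrable := hF.integrable.sub hG.integrable
  eq t ht := by
    have hb : b ∈ Icc a b := right_mem_Icc.2 (ht.1.trans ht.2)
    rw [intervalIntegral.integral_sub (intervalIntegrable_sub hF.integrable ht hb)
      (intervalIntegrable_sub hG.integrable ht hb), hF.eq t ht, hG.eq t ht]
    abel

lemma finset_sum {ι : Type*} (s : Finset ι) {F f : ι → ℝ → E}
    (h : ∀ i ∈ s, IsPrimitive a b (F i) (f i)) :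
    IsPrimitive a b (fun t => ∑ i ∈ s, F i t) (fun t => ∑ i ∈ s, f i t) where
  integrable := integrable_finsetSum _ fun i hi => (h i hi).integrable
  eq t ht := by
    have hb : b ∈ Icc a b := right_mem_Icc.2 (ht.1.trans ht.2)
    rw [intervalIntegral.integral_finsetSum fun i hi =>
      intervalIntegrable_sub (h i hi).integrable ht hb, ← Finset.sum_sub_distrib]
    exact Finset.sum_congr rfl fun i hi => (h i hi).eq t ht

lemma congr {f' : ℝ → E} (h : IsPrimitive a b F f) (hf : ∀ t ∈ Icc a b, f t = f' t) :
    IsPrimitive a b F f' where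
  integrable := h.integrable.congr_fun hf measurableSet_Icc
  eq t ht := by
    rw [h.eq t ht]
    congr 1
    refine intervalIntegral.integral_congr fun s hs => hf s ?_
    rw [uIcc_of_le ht.2] at hs
    exact ⟨ht.1.trans hs.1, hs.2⟩

lemma eq_of_zero {F : ℝ → E} (h : IsPrimitive a b F fun _ => 0) {t : ℝ} (ht : t ∈ Icc a b) :
    F t = F b := by
  simpa using h.eq t ht

/-- Integration by parts for absolutely continuous functions. -/
lemma mul_real {F f G g : ℝ → ℝ} (hF : IsPrimitive a b F f) (hG : IsPrimitive a b G g) :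
    IsPrimitive a b (fun t => F t * G t) (fun t => f t * G t + F t * g t) where
  integrable := (hF.integrable.mul_continuousOn hG.continuousOn isCompact_Icc).add
    (hG.integrable.continuousOn_mul hF.continuousOn isCompact_Icc)
  eq t ht := by
    -- `F` is controlled only on `[a,b]`, so it is replaced by `x ↦ F b + ∫_b^x f`, which agrees
    -- with it on `[t,b]` and has derivative `f` a.e. there.
    have key : ∀ {F f : ℝ → ℝ}, IsPrimitive a b F f →
        AbsolutelyContinuousOnInterval (fun x => F b + ∫ s in b..x, f s) t b ∧
        (∀ᵐ x, x ∈ uIcc t b → deriv (fun x => F b + ∫ s in b..x, f s) x = f x) ∧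
        ∀ x ∈ Icc t b, F b + ∫ s in b..x, f s = F x := by
      intro F f hF
      have hii : IntervalIntegrable f volume t b :=
        intervalIntegrable_sub hF.integrable ht (right_mem_Icc.2 (ht.1.trans ht.2))
      refine ⟨?_, ?_, ?_⟩
      · exact ((LipschitzWith.const (F b)).lipschitzOnWith.absolutelyContinuousOnInterval).add
          (hii.absolutelyContinuousOnInterval_intervalIntegral right_mem_uIcc)
      · filter_upwards [hii.ae_hasDerivAt_integral] with x hx hxm
        exact ((hx hxm b right_mem_uIcc).const_add (F b)).deriv
      · intro x hx
        rw [hF.eq x ⟨ht.1.trans hx.1, hx.2⟩, intervalIntegral.integral_symm]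
        ring
    obtain ⟨aF, dF, eF⟩ := key hF
    obtain ⟨aG, dG, eG⟩ := key hG
    have h := aF.integral_deriv_mul_eq_sub aG
    have h2 : ∫ s in t..b, f s * G s + F s * g s = F b * G b - F t * G t := by
      rw [← eF t (left_mem_Icc.2 ht.2), ← eG t (left_mem_Icc.2 ht.2)]
      simp only [intervalIntegral.integral_same, add_zero] at h
      rw [← h]
      apply intervalIntegral.integral_congr_ae
      filter_upwards [dF, dG] with x h1 h2 hx
      have hx' := uIoc_subset_uIcc hx
      rw [h1 hx', h2 hx', eF x (by rwa [uIcc_of_le ht.2] at hx'),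
        eG x (by rwa [uIcc_of_le ht.2] at hx')]
    rw [h2]
    ring

variable {p q r : Type*} [Fintype p] [Fintype q] [Fintype r]

lemma of_entries {F f : ℝ → Matrix p q ℝ}
    (h : ∀ i j, IsPrimitive a b (fun t => F t i j) (fun t => f t i j)) : IsPrimitive a b F f := by
  have hint : IntegrableOn f (Icc a b) :=
    memLp_one_iff_integrable.1 (memLp_matrix.2 fun i j =>
      memLp_one_iff_integrable.2 (h i j).integrable)
  refine ⟨hint, fun t ht => ?_⟩
  ext i j
  have := (entryCLM i j).intervalIntegral_comp_comm
    (intervalIntegrable_sub hint ht (right_mem_Icc.2 (ht.1.trans ht.2)))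
  simp only [entryCLM_apply] at this
  rw [Matrix.sub_apply, ← this]
  exact (h i j).eq t ht

lemma mul {F f : ℝ → Matrix p q ℝ} {G g : ℝ → Matrix q r ℝ} (hF : IsPrimitive a b F f)
    (hG : IsPrimitive a b G g) :
    IsPrimitive a b (fun t => F t * G t) (fun t => f t * G t + F t * g t) := by
  refine of_entries fun i j => ?_
  simp only [Matrix.mul_apply, Matrix.add_apply, ← Finset.sum_add_distrib]
  exact finset_sum _ fun l _ => (hF.clm (entryCLM i l)).mul_real (hG.clm (entryCLM l j))

lemma transpose {F f : ℝ → Matrix p q ℝ} (hF : IsPrimitive a b F f) :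
    IsPrimitive a b (fun t => (F t)ᵀ) (fun t => (f t)ᵀ) :=
  hF.clm transposeCLM

end IsPrimitive

/-! ### Linear systems with integrable coefficients -/

/-- Gronwall is applied on `[t,b]` instead of `[a,b]`, with the forcing frozen at `∫_t^b e`. The
bound thus involves only the future of `t`, and all later estimates inherit this causality. -/
lemma IsPrimitive.norm_le {E : Type*} [NormedAddCommGroup E] [NormedSpace ℝ E] {a b : ℝ}
    {F f : ℝ → E} (h : IsPrimitive a b F f) {e k : ℝ → ℝ} (he : IntegrableOn e (Icc a b))
    (he0 : ∀ s, 0 ≤ e s) (hk : IntegrableOn k (Icc a b)) (hk0 : ∀ s, 0 ≤ k s)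
    (hf : ∀ s ∈ Icc a b, ‖f s‖ ≤ e s + k s * ‖F s‖) {t : ℝ} (ht : t ∈ Icc a b) :
    ‖F t‖ ≤ 2 * (‖F b‖ + ∫ s in t..b, e s) * Real.exp (2 * ∫ s in t..b, k s) := by
  have hsub : Icc t b ⊆ Icc a b := Icc_subset_Icc_left ht.1
  have hb : b ∈ Icc a b := right_mem_Icc.2 (ht.1.trans ht.2)
  have hFc := h.continuousOn
  refine gronwall_backward (hk.mono_set hsub) hk0 (hFc.norm.mono hsub)
    (add_nonneg (norm_nonneg _) (tail_nonneg he0 ht.2)) (fun x hx => ?_) (left_mem_Icc.2 ht.2)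
  have hx' := hsub hx
  have hkF := intervalIntegrable_sub (integrableOn_mul_continuousOn hk hFc.norm) hx' hb
  have hex := intervalIntegrable_sub he hx' hb
  calc ‖F x‖ = ‖F b - ∫ s in x..b, f s‖ := by rw [← h.eq x hx']
    _ ≤ ‖F b‖ + ‖∫ s in x..b, f s‖ := norm_sub_le _ _
    _ ≤ ‖F b‖ + ∫ s in x..b, ‖f s‖ := by
        gcongr
        exact intervalIntegral.norm_integral_le_integral_norm hx.2
    _ ≤ ‖F b‖ + ∫ s in x..b, (e s + k s * ‖F s‖) := by
        gcongr
        refine intervalIntegral.integral_mono_on hx.2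
          (intervalIntegrable_sub h.integrable hx' hb).norm (hex.add hkF) fun s hs => ?_
        exact hf s ⟨hx'.1.trans hs.1, hs.2⟩
    _ = (‖F b‖ + ∫ s in x..b, e s) + ∫ s in x..b, k s * ‖F s‖ := by
        rw [intervalIntegral.integral_add hex hkF, add_assoc]
    _ ≤ (‖F b‖ + ∫ s in t..b, e s) + ∫ s in x..b, k s * ‖F s‖ := by
        gcongr
        exact tail_antitone he he0 ht hx' hx.1

lemma IsPrimitive.eq_zero {E : Type*} [NormedAddCommGroup E] [NormedSpace ℝ E] {a b : ℝ}
    {F f : ℝ → E} (h : IsPrimitive a b F f) {k : ℝ → ℝ}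
    (hk : IntegrableOn k (Icc a b)) (hk0 : ∀ s, 0 ≤ k s)
    (hf : ∀ s ∈ Icc a b, ‖f s‖ ≤ k s * ‖F s‖) (hFb : F b = 0) {t : ℝ} (ht : t ∈ Icc a b) :
    F t = 0 := by
  have := h.norm_le (e := fun _ => 0) (by simp) (fun _ => le_rfl) hk hk0
    (fun s hs => by simpa using hf s hs) ht
  simpa [hFb] using this

lemma tail_norm_le {E : Type*} [NormedAddCommGroup E] {T : ℝ} (hT : 0 ≤ T) {a : ℝ → E}
    (ha : IntegrableOn a (Icc 0 T)) {L t : ℝ} (hL : ∫ s in 0..T, ‖a s‖ ≤ L)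
    (ht : t ∈ Icc 0 T) : ∫ s in t..T, ‖a s‖ ≤ L :=
  (tail_antitone ha.norm (fun s => norm_nonneg (a s)) (left_mem_Icc.2 hT) ht ht.1).trans hL

section Transition

variable {p q : Type*} [Fintype p] [Fintype q] {T : ℝ}

lemma integrableOn_mul_left {a : ℝ → Matrix p p ℝ} {u : ℝ → Matrix p q ℝ}
    (ha : IntegrableOn a (Icc 0 T)) (hu : ContinuousOn u (Icc 0 T)) :
    IntegrableOn (fun s => a s * u s) (Icc 0 T) :=
  memLp_one_iff_integrable.1
    ((memLp_one_iff_integrable.2 ha).mmul (memLp_top_of_continuousOn isCompact_Icc hu))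

lemma integrableOn_neg_transpose {a : ℝ → Matrix p p ℝ} (ha : IntegrableOn a (Icc 0 T)) :
    IntegrableOn (fun s => -(a s)ᵀ) (Icc 0 T) :=
  (memLp_one_iff_integrable.1 (memLp_one_iff_integrable.2 ha).mtranspose).neg

variable [DecidableEq p]

lemma exists_fundamental (hT : 0 ≤ T) {a : ℝ → Matrix p p ℝ} (ha : IntegrableOn a (Icc 0 T)) :
    ∃ X : ℝ → Matrix p p ℝ, IsPrimitive 0 T X (fun s => a s * X s) ∧ X T = 1 := by
  have hTm : T ∈ Icc 0 T := right_mem_Icc.2 hT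
  obtain ⟨X, hXc, hX⟩ := exists_fixedPoint_backward hT ha.norm (fun s => norm_nonneg (a s))
    (fun (u : ℝ → Matrix p p ℝ) t => 1 - ∫ s in t..T, a s * u s)
    (fun u hu => continuousOn_const.sub (continuousOn_tail (integrableOn_mul_left ha hu)))
    (fun u v hu hv t ht => by
      have h1 := intervalIntegrable_sub (integrableOn_mul_left ha hu) ht hTm
      have h2 := intervalIntegrable_sub (integrableOn_mul_left ha hv) ht hTm
      rw [sub_sub_sub_cancel_left, ← intervalIntegral.integral_sub h2 h1]
      refine (intervalIntegral.norm_integral_le_integral_norm ht.2).trans ?_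
      refine intervalIntegral.integral_mono_on ht.2 (h2.sub h1).norm
        (intervalIntegrable_sub (integrableOn_mul_continuousOn ha.norm (hu.sub hv).norm) ht hTm)
        fun s _ => ?_
      rw [← Matrix.mul_sub, norm_sub_rev (u s)]
      exact Matrix.frobenius_norm_mul _ _)
  have hXT : X T = 1 := by simpa using hX T hTm
  exact ⟨X, ⟨integrableOn_mul_left ha hXc, fun t ht => by rw [hXT]; exact hX t ht⟩, hXT⟩

/-- The solution of `X' = a X` with `X(T) = 1`. -/
def fundSol (T : ℝ) (a : ℝ → Matrix p p ℝ) : ℝ → Matrix p p ℝ :=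
  Classical.epsilon fun X => IsPrimitive 0 T X (fun s => a s * X s) ∧ X T = 1

/-- The solution of `Y' = - Y a` with `Y(T) = 1`. -/
def fundSolInv (T : ℝ) (a : ℝ → Matrix p p ℝ) (t : ℝ) : Matrix p p ℝ :=
  (fundSol T (fun s => -(a s)ᵀ) t)ᵀ

section

variable (hT : 0 ≤ T) {a : ℝ → Matrix p p ℝ} (ha : IntegrableOn a (Icc 0 T))

include hT ha

lemma fundSol_isPrimitive : IsPrimitive 0 T (fundSol T a) (fun s => a s * fundSol T a s) :=
  (Classical.epsilon_spec (exists_fundamental hT ha)).1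

lemma fundSol_right : fundSol T a T = 1 :=
  (Classical.epsilon_spec (exists_fundamental hT ha)).2

/-- The inverse is built as a transposed solution of the adjoint system, so bounds for `fundSol`
pass to it by transposition. -/
lemma fundSolInv_isPrimitive :
    IsPrimitive 0 T (fundSolInv T a) (fun s => -(fundSolInv T a s * a s)) := by
  have h := (fundSol_isPrimitive hT (integrableOn_neg_transpose ha)).transpose
  refine h.congr fun t _ => ?_
  simp [fundSolInv]

lemma fundSolInv_right : fundSolInv T a T = 1 := by
  simp [fundSolInv, fundSol_right hT (integrableOn_neg_transpose ha)]

/-- The product has derivative `-Y a X + Y a X = 0`, hence keeps its terminal value. -/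
lemma fundSolInv_mul_fundSol {t : ℝ} (ht : t ∈ Icc 0 T) :
    fundSolInv T a t * fundSol T a t = 1 := by
  have h := (fundSolInv_isPrimitive hT ha).mul (fundSol_isPrimitive hT ha)
  have h0 := h.congr (f' := fun _ => 0) fun t _ => by simp [Matrix.mul_assoc]
  simpa [fundSol_right hT ha, fundSolInv_right hT ha] using h0.eq_of_zero ht

lemma fundSol_mul_fundSolInv {t : ℝ} (ht : t ∈ Icc 0 T) :
    fundSol T a t * fundSolInv T a t = 1 :=
  mul_eq_one_comm.1 (fundSolInv_mul_fundSol hT ha ht)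

lemma fundSol_norm_le {L t : ℝ} (hL : ∫ s in 0..T, ‖a s‖ ≤ L) (ht : t ∈ Icc 0 T) :
    ‖fundSol T a t‖ ≤ 2 * ‖(1 : Matrix p p ℝ)‖ * Real.exp (2 * L) := by
  have h := (fundSol_isPrimitive hT ha).norm_le (e := fun _ => 0) (by simp) (fun _ => le_rfl)
    ha.norm (fun s => norm_nonneg (a s))
    (fun s _ => by simpa using Matrix.frobenius_norm_mul _ _) ht
  rw [fundSol_right hT ha] at h
  refine h.trans ?_
  have := tail_norm_le hT ha hL ht
  simp only [intervalIntegral.integral_zero, add_zero]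
  gcongr

/-- The difference `D` vanishes at `T` and solves `D' = a D + (a - b) X_b`. The forcing is at most
`C ‖a - b‖`, where `C` is the bound of `fundSol_norm_le`. -/
lemma fundSol_sub_le {b : ℝ → Matrix p p ℝ} (hb : IntegrableOn b (Icc 0 T)) {L t : ℝ}
    (hL : ∫ s in 0..T, ‖a s‖ ≤ L) (hL' : ∫ s in 0..T, ‖b s‖ ≤ L) (ht : t ∈ Icc 0 T) :
    ‖fundSol T a t - fundSol T b t‖
      ≤ 4 * ‖(1 : Matrix p p ℝ)‖ * Real.exp (2 * L) ^ 2 * ∫ s in t..T, ‖a s - b s‖ := by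
  set C := 2 * ‖(1 : Matrix p p ℝ)‖ * Real.exp (2 * L) with hC
  have h := ((fundSol_isPrimitive hT ha).sub (fundSol_isPrimitive hT hb)).norm_le
    (e := fun s => C * ‖a s - b s‖) (k := fun s => ‖a s‖) ((ha.sub hb).norm.const_mul C)
    (fun s => by positivity) ha.norm (fun s => norm_nonneg (a s)) (fun s hs => ?_) ht
  · rw [fundSol_right hT ha, fundSol_right hT hb, sub_self, norm_zero, zero_add,
      intervalIntegral.integral_const_mul] at h
    refine h.trans ?_
    have h2 := tail_norm_le hT ha hL ht
    have h3 : 0 ≤ ∫ s in t..T, ‖a s - b s‖ := tail_nonneg (fun s => norm_nonneg _) ht.2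
    calc _ ≤ 2 * (C * ∫ s in t..T, ‖a s - b s‖) * Real.exp (2 * L) := by gcongr
      _ = _ := by rw [hC]; ring
  · have : a s * fundSol T a s - b s * fundSol T b s
        = (a s - b s) * fundSol T b s + a s * (fundSol T a s - fundSol T b s) := by
      rw [Matrix.sub_mul, Matrix.mul_sub]; abel
    rw [this]
    refine (norm_add_le _ _).trans (add_le_add ?_ (Matrix.frobenius_norm_mul _ _))
    refine (Matrix.frobenius_norm_mul _ _).trans ?_
    rw [mul_comm C]
    exact mul_le_mul_of_nonneg_left (fundSol_norm_le hT hb hL' hs) (norm_nonneg _)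

lemma fundSolInv_norm_le {L t : ℝ} (hL : ∫ s in 0..T, ‖a s‖ ≤ L) (ht : t ∈ Icc 0 T) :
    ‖fundSolInv T a t‖ ≤ 2 * ‖(1 : Matrix p p ℝ)‖ * Real.exp (2 * L) := by
  rw [fundSolInv, Matrix.frobenius_norm_transpose]
  exact fundSol_norm_le hT (integrableOn_neg_transpose ha) (by simpa using hL) ht

lemma fundSolInv_sub_le {b : ℝ → Matrix p p ℝ} (hb : IntegrableOn b (Icc 0 T)) {L t : ℝ}
    (hL : ∫ s in 0..T, ‖a s‖ ≤ L) (hL' : ∫ s in 0..T, ‖b s‖ ≤ L) (ht : t ∈ Icc 0 T) :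
    ‖fundSolInv T a t - fundSolInv T b t‖
      ≤ 4 * ‖(1 : Matrix p p ℝ)‖ * Real.exp (2 * L) ^ 2 * ∫ s in t..T, ‖a s - b s‖ := by
  rw [fundSolInv, fundSolInv, ← Matrix.transpose_sub, Matrix.frobenius_norm_transpose]
  refine (fundSol_sub_le hT (integrableOn_neg_transpose ha) (integrableOn_neg_transpose hb)
    (by simpa using hL) (by simpa using hL') ht).trans (le_of_eq ?_)
  congr 2
  ext s
  rw [← Matrix.frobenius_norm_transpose (a s - b s), Matrix.transpose_sub, ← norm_neg]
  congr 1
  abel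

end

lemma matInt_eq {p q : ℕ} {a b : ℝ} {F : ℝ → Matrix (Fin p) (Fin q) ℝ}
    (hF : IntervalIntegrable F volume a b) : matInt a b F = ∫ s in a..b, F s := by
  ext i j
  exact ((entryCLM i j).intervalIntegral_comp_comm hF)

lemma matInt_congr {p q : ℕ} {a b : ℝ} {F F' : ℝ → Matrix (Fin p) (Fin q) ℝ} (hab : a ≤ b)
    (h : ∀ s ∈ Icc a b, F s = F' s) : matInt a b F = matInt a b F' := by
  ext i j
  refine intervalIntegral.integral_congr fun s hs => ?_
  rw [uIcc_of_le hab] at hs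
  simp only [h s hs]

section

variable {n : ℕ} (hT : 0 ≤ T) {a : ℝ → Matrix (Fin n) (Fin n) ℝ} (ha : IntegrableOn a (Icc 0 T))

include hT ha

lemma isTransition_fundSol :
    IsTransition T a (fun s t => fundSol T a s * fundSolInv T a t) := by
  have hX := fundSol_isPrimitive hT ha
  intro s hs
  have hc : ContinuousOn (fun t => fundSol T a t * fundSolInv T a s) (Icc 0 T) :=
    hX.continuousOn.mmul continuousOn_const
  refine ⟨hc, fun t ht => ?_⟩
  rw [matInt_eq (intervalIntegrable_sub (integrableOn_mul_left ha hc) hs ht)]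
  have h1 := (sandwichCLM (1 : Matrix (Fin n) (Fin n) ℝ)
    (fundSolInv T a s)).intervalIntegral_comp_comm (intervalIntegrable_sub hX.integrable hs ht)
  simp only [sandwichCLM_apply, Matrix.one_mul, Matrix.mul_assoc] at h1
  have h2 := tail_add hX.integrable hs ht
  have h3 := hX.eq s hs
  have h4 := hX.eq t ht
  have h5 : fundSol T a t = fundSol T a s + ∫ r in s..t, a r * fundSol T a r := by
    rw [h4, h3, h2]; abel
  change fundSol T a t * fundSolInv T a s = _
  rw [h1, h5, Matrix.add_mul, fundSol_mul_fundSolInv hT ha hs]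

/-- `Φ(·,t)` and `X Φ(T,t)` solve the same linear system and agree at `T`, hence everywhere.
Evaluation at `t`, where `Φ(t,t) = 1`, identifies `Φ(T,t)` with `Y(t)`. -/
lemma IsTransition.eq_fundSol {Φ : ℝ → ℝ → Matrix (Fin n) (Fin n) ℝ} (hΦ : IsTransition T a Φ)
    {s t : ℝ} (hs : s ∈ Icc 0 T) (ht : t ∈ Icc 0 T) :
    Φ s t = fundSol T a s * fundSolInv T a t := by
  obtain ⟨hc0, h⟩ := hΦ t ht
  have hc : ContinuousOn (fun r => Φ r t) (Icc 0 T) := hc0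
  have hTm : T ∈ Icc 0 T := right_mem_Icc.2 hT
  have hi := integrableOn_mul_left ha hc
  have hP : IsPrimitive 0 T (fun r => Φ r t) (fun r => a r * Φ r t) := by
    refine ⟨hi, fun r hr => ?_⟩
    rw [h r hr, h T hTm, matInt_eq (intervalIntegrable_sub hi ht hr),
      matInt_eq (intervalIntegrable_sub hi ht hTm), tail_add hi ht hr]
    abel
  have hX := (fundSol_isPrimitive hT ha).clm (sandwichCLM (1 : Matrix (Fin n) (Fin n) ℝ) (Φ T t))
  simp only [sandwichCLM_apply, Matrix.one_mul] at hX
  have hD := fun r hr => (hP.sub hX).eq_zero (t := r) ha.norm (fun s => norm_nonneg (a s))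
    (fun r _ => by
      rw [Matrix.mul_assoc, ← Matrix.mul_sub]
      exact Matrix.frobenius_norm_mul _ _) (by simp [fundSol_right hT ha]) hr
  have e1 : ∀ r ∈ Icc 0 T, Φ r t = fundSol T a r * Φ T t := fun r hr => sub_eq_zero.1 (hD r hr)
  have e2 : Φ t t = 1 := by
    rw [h t ht, matInt_eq (intervalIntegrable_sub hi ht ht)]; simp
  have e3 : Φ T t = fundSolInv T a t := by
    calc Φ T t = (fundSolInv T a t * fundSol T a t) * Φ T t := by
          rw [fundSolInv_mul_fundSol hT ha ht, Matrix.one_mul]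
      _ = fundSolInv T a t := by rw [Matrix.mul_assoc, ← e1 t ht, e2, Matrix.mul_one]
  rw [e1 s hs, e3]

end

end Transition

/-! ### Integrals over a triangle -/

section Triangle

variable {E : Type*} [NormedAddCommGroup E] [NormedSpace ℝ E] {T : ℝ} {F : ℝ → ℝ → E}

omit [NormedSpace ℝ E] in
lemma integrable_triangle
    (hF : Integrable (Function.uncurry F)
      ((volume.restrict (Icc 0 T)).prod (volume.restrict (Icc 0 T)))) {t : ℝ}
    (ht : t ∈ Icc 0 T) :
    Integrable ({z : ℝ × ℝ | z.1 ≤ z.2}.indicator (Function.uncurry F))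
      ((volume.restrict (Ioc t T)).prod (volume.restrict (Ioc t T))) := by
  refine Integrable.indicator ?_ (measurableSet_le measurable_fst measurable_snd)
  rw [Measure.prod_restrict] at hF ⊢
  have hsub : Ioc t T ⊆ Icc 0 T := fun s hs => ⟨ht.1.trans hs.1.le, hs.2⟩
  exact hF.mono_measure (Measure.restrict_mono (prod_mono hsub hsub) le_rfl)

lemma integral_triangle_fst (t : ℝ) {s : ℝ} (hs : s ∈ Ioc t T) :
    ∫ r in Ioc t T, {z : ℝ × ℝ | z.1 ≤ z.2}.indicator (Function.uncurry F) (r, s)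
      = ∫ r in t..s, F r s := by
  have h : (fun r => {z : ℝ × ℝ | z.1 ≤ z.2}.indicator (Function.uncurry F) (r, s))
      = (Iic s).indicator (fun r => F r s) := by
    ext r
    by_cases hr : r ≤ s <;> simp [indicator, hr]
  rw [h, setIntegral_indicator measurableSet_Iic, intervalIntegral.integral_of_le hs.1.le]
  congr 2
  ext r
  exact ⟨fun h => ⟨h.1.1, h.2⟩, fun h => ⟨⟨h.1, h.2.trans hs.2⟩, h.2⟩⟩

lemma integral_triangle_snd (t : ℝ) {r : ℝ} (hr : r ∈ Ioc t T) :
    ∫ s in Ioc t T, {z : ℝ × ℝ | z.1 ≤ z.2}.indicator (Function.uncurry F) (r, s)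
      = ∫ s in r..T, F r s := by
  have h : (fun s => {z : ℝ × ℝ | z.1 ≤ z.2}.indicator (Function.uncurry F) (r, s))
      = (Ici r).indicator (fun s => F r s) := by
    ext s
    by_cases hs : r ≤ s <;> simp [indicator, hs]
  rw [h, setIntegral_indicator measurableSet_Ici, intervalIntegral.integral_of_le hr.2,
    ← integral_Icc_eq_integral_Ioc]
  congr 2
  ext s
  exact ⟨fun h => ⟨h.2, h.1.2⟩, fun h => ⟨⟨hr.1.trans_le h.1, h.2⟩, h.1⟩⟩

variable (hF : Integrable (Function.uncurry F)
  ((volume.restrict (Icc 0 T)).prod (volume.restrict (Icc 0 T))))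

include hF

/-- Fubini for the indicator of `r ≤ s`. It replaces differentiation under an integral whose lower
limit also moves. -/
lemma integral_triangle_swap {t : ℝ} (ht : t ∈ Icc 0 T) :
    ∫ s in t..T, ∫ r in t..s, F r s = ∫ r in t..T, ∫ s in r..T, F r s := by
  rw [intervalIntegral.integral_of_le ht.2, intervalIntegral.integral_of_le ht.2,
    setIntegral_congr_fun measurableSet_Ioc fun s hs => (integral_triangle_fst t hs).symm,
    setIntegral_congr_fun measurableSet_Ioc fun r hr => (integral_triangle_snd t hr).symm]
  exact (integral_integral_swap
    (f := fun r s => {z : ℝ × ℝ | z.1 ≤ z.2}.indicator (Function.uncurry F) (r, s))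
    (integrable_triangle hF ht)).symm

lemma integrableOn_triangle_fst {t : ℝ} (ht : t ∈ Icc 0 T) :
    IntervalIntegrable (fun s => ∫ r in t..s, F r s) volume t T := by
  rw [intervalIntegrable_iff_integrableOn_Ioc_of_le ht.2]
  exact IntegrableOn.congr_fun (integrable_triangle hF ht).integral_prod_right
    (fun s hs => integral_triangle_fst t hs) measurableSet_Ioc

lemma integrableOn_triangle_snd (hT : 0 ≤ T) :
    IntegrableOn (fun r => ∫ s in r..T, F r s) (Icc 0 T) := by
  rw [integrableOn_Icc_iff_integrableOn_Ioc]
  exact IntegrableOn.congr_fun (integrable_triangle hF (left_mem_Icc.2 hT)).integral_prod_left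
    (fun s hs => integral_triangle_snd 0 hs) measurableSet_Ioc

end Triangle

/-! ### Quadratic costs along a linear system -/

/-- `K` is continuous on the square and continuously differentiable in the first variable, with
partial derivative `Kt`. -/
structure IsC1Kernel {ι : Type*} [Fintype ι] (T : ℝ) (K Kt : ℝ → ℝ → Matrix ι ι ℝ) : Prop where
  cont : ContinuousOn (fun z : ℝ × ℝ => K z.1 z.2) (Icc 0 T ×ˢ Icc 0 T)
  cont_t : ContinuousOn (fun z : ℝ × ℝ => Kt z.1 z.2) (Icc 0 T ×ˢ Icc 0 T)
  ftc : ∀ t s, 0 ≤ t → t ≤ s → s ≤ T → K t s = K s s - ∫ r in t..s, Kt r s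

section Cost

variable {p ι : Type*} [Fintype p] [Fintype ι] {T : ℝ} {K Kt : ℝ → ℝ → Matrix ι ι ℝ}

lemma continuousOn_section (hK : ContinuousOn (fun z : ℝ × ℝ => K z.1 z.2) (Icc 0 T ×ˢ Icc 0 T))
    {t : ℝ} (ht : t ∈ Icc 0 T) : ContinuousOn (fun s => K t s) (Icc 0 T) :=
  hK.comp (f := fun s => (t, s)) (by fun_prop) fun _ hs => ⟨ht, hs⟩

lemma continuousOn_section_fst
    (hK : ContinuousOn (fun z : ℝ × ℝ => K z.1 z.2) (Icc 0 T ×ˢ Icc 0 T))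
    {s : ℝ} (hs : s ∈ Icc 0 T) : ContinuousOn (fun t => K t s) (Icc 0 T) :=
  hK.comp (f := fun t => (t, s)) (by fun_prop) fun _ ht => ⟨ht, hs⟩

lemma continuousOn_diag (hK : ContinuousOn (fun z : ℝ × ℝ => K z.1 z.2) (Icc 0 T ×ˢ Icc 0 T)) :
    ContinuousOn (fun t => K t t) (Icc 0 T) :=
  hK.comp (f := fun t => (t, t)) (by fun_prop) fun _ ht => ⟨ht, ht⟩

lemma memLp_sandwich {Z : ℝ → Matrix ι p ℝ} {k : ℝ → Matrix ι ι ℝ}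
    (hZ : MemLp Z ⊤ (volume.restrict (Icc 0 T))) (hk : ContinuousOn k (Icc 0 T)) :
    MemLp (fun s => (Z s)ᵀ * k s * Z s) ⊤ (volume.restrict (Icc 0 T)) :=
  MemLp.mmul (P := ⊤) (Q := ⊤) (MemLp.mmul (P := ⊤) (Q := ⊤) hZ.mtranspose
    (memLp_top_of_continuousOn isCompact_Icc hk)) hZ

lemma integrableOn_sandwich {Z : ℝ → Matrix ι p ℝ} {k : ℝ → Matrix ι ι ℝ}
    (hZ : MemLp Z ⊤ (volume.restrict (Icc 0 T))) (hk : ContinuousOn k (Icc 0 T)) :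
    IntegrableOn (fun s => (Z s)ᵀ * k s * Z s) (Icc 0 T) :=
  (memLp_sandwich hZ hk).integrable le_top

/-- A Leibniz rule for merely bounded measurable `Z`: insert `K(t,s) = K(s,s) - ∫_t^s K_t(r,s) dr`
and exchange the order of integration over the triangle. -/
lemma IsC1Kernel.isPrimitive (hT : 0 ≤ T) (hK : IsC1Kernel T K Kt) {Z : ℝ → Matrix ι p ℝ}
    (hZ : MemLp Z ⊤ (volume.restrict (Icc 0 T))) :
    IsPrimitive 0 T (fun t => ∫ s in t..T, (Z s)ᵀ * K t s * Z s)
      (fun t => -((Z t)ᵀ * K t t * Z t - ∫ s in t..T, (Z s)ᵀ * Kt t s * Z s)) := by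
  have hTm : T ∈ Icc 0 T := right_mem_Icc.2 hT
  have hF : Integrable (Function.uncurry fun r s => (Z s)ᵀ * Kt r s * Z s)
      ((volume.restrict (Icc 0 T)).prod (volume.restrict (Icc 0 T))) := by
    have hZ2 : MemLp (fun z : ℝ × ℝ => Z z.2) ⊤
        ((volume.restrict (Icc 0 T)).prod (volume.restrict (Icc 0 T))) := hZ.comp_snd _
    have hK2 : MemLp (fun z : ℝ × ℝ => Kt z.1 z.2) ⊤
        ((volume.restrict (Icc 0 T)).prod (volume.restrict (Icc 0 T))) := by
      rw [Measure.prod_restrict]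
      exact memLp_top_of_continuousOn (isCompact_Icc.prod isCompact_Icc) hK.cont_t
    have := MemLp.mmul (P := ⊤) (Q := ⊤) (R := ⊤)
      (MemLp.mmul (P := ⊤) (Q := ⊤) (R := ⊤) hZ2.mtranspose hK2) hZ2
    exact this.integrable le_top
  have hdiag := integrableOn_sandwich hZ (continuousOn_diag hK.cont)
  have hsnd := integrableOn_triangle_snd hF hT
  refine ⟨(hdiag.sub hsnd).neg, fun t ht => ?_⟩
  have hdt := intervalIntegrable_sub hdiag ht hTm
  have hst := intervalIntegrable_sub hsnd ht hTm
  simp only [intervalIntegral.integral_same, zero_sub, intervalIntegral.integral_neg, neg_neg]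
  rw [intervalIntegral.integral_sub hdt hst, ← integral_triangle_swap hF ht,
    ← intervalIntegral.integral_sub hdt (integrableOn_triangle_fst hF ht)]
  refine intervalIntegral.integral_congr fun s hs => ?_
  rw [uIcc_of_le ht.2] at hs
  have hs' : s ∈ Icc 0 T := ⟨ht.1.trans hs.1, hs.2⟩
  have hi : IntervalIntegrable (fun r => Kt r s) volume t s :=
    intervalIntegrable_sub ((continuousOn_section_fst hK.cont_t hs').integrableOn_compact
      isCompact_Icc) ht hs'
  have h := (sandwichCLM (Z s)ᵀ (Z s)).intervalIntegral_comp_comm hi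
  simp only [sandwichCLM_apply] at h
  rw [hK.ftc t s ht.1 hs.1 hs.2, h, Matrix.mul_sub, Matrix.sub_mul]

lemma posSemidef_integral {F : ℝ → Matrix p p ℝ} {a b : ℝ} (hab : a ≤ b)
    (h : ∀ s ∈ Icc a b, (F s).PosSemidef) : (∫ s in a..b, F s).PosSemidef := by
  by_cases hF : IntervalIntegrable F volume a b
  · rw [Matrix.posSemidef_iff_dotProduct_mulVec]
    refine ⟨?_, fun x => ?_⟩
    · have h1 := (transposeCLM (p := p) (q := p)).intervalIntegral_comp_comm hF
      rw [Matrix.IsHermitian, Matrix.conjTranspose_eq_transpose_of_trivial,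
        ← transposeCLM_apply, ← h1]
      refine intervalIntegral.integral_congr fun s hs => ?_
      rw [uIcc_of_le hab] at hs
      have := (h s hs).1
      rwa [Matrix.IsHermitian, Matrix.conjTranspose_eq_transpose_of_trivial] at this
    · let L : Matrix p p ℝ →L[ℝ] ℝ := LinearMap.toContinuousLinearMap
        { toFun := fun A => star x ⬝ᵥ A *ᵥ x
          map_add' := fun A B => by rw [Matrix.add_mulVec, dotProduct_add]
          map_smul' := fun c A => by rw [Matrix.smul_mulVec, dotProduct_smul]; rfl }
      have h1 := L.intervalIntegral_comp_comm hF
      change 0 ≤ L _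
      rw [← h1]
      exact intervalIntegral.integral_nonneg hab fun s hs =>
        (Matrix.posSemidef_iff_dotProduct_mulVec.1 (h s hs)).2 x
  -- Without integrability the integral is 0 by convention, which is positive semidefinite.
  · rw [intervalIntegral.integral_undef hF]
    exact Matrix.PosSemidef.zero

lemma posSemidef_sandwich {q : Type*} [Fintype q] {N : Matrix q q ℝ} (hN : N.PosSemidef)
    (Z : Matrix q p ℝ) : (Zᵀ * N * Z).PosSemidef := by
  have := hN.conjTranspose_mul_mul_same Z
  rwa [Matrix.conjTranspose_eq_transpose_of_trivial] at this

lemma norm_sandwich_sub_le {q : Type*} [Fintype q] {A A' : Matrix q p ℝ} {N N' : Matrix q q ℝ}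
    {x ν : ℝ} (hA : ‖A‖ ≤ x) (hA' : ‖A'‖ ≤ x) (hN : ‖N‖ ≤ ν) (hN' : ‖N'‖ ≤ ν) :
    ‖Aᵀ * N * A - A'ᵀ * N' * A'‖ ≤ 2 * x * ν * ‖A - A'‖ + x ^ 2 * ‖N - N'‖ := by
  have hx : 0 ≤ x := (norm_nonneg _).trans hA
  have hν : 0 ≤ ν := (norm_nonneg _).trans hN
  have h3 : ∀ {B C : Matrix q p ℝ} {R : Matrix q q ℝ} {β γ ρ : ℝ}, ‖B‖ ≤ β → ‖C‖ ≤ γ → ‖R‖ ≤ ρ →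
      ‖Bᵀ * R * C‖ ≤ β * ρ * γ := by
    intro B C R β γ ρ hB hC hR
    have hβ : 0 ≤ β := (norm_nonneg _).trans hB
    have hρ : 0 ≤ ρ := (norm_nonneg _).trans hR
    refine (Matrix.frobenius_norm_mul _ _).trans ?_
    refine mul_le_mul ((Matrix.frobenius_norm_mul _ _).trans ?_) hC (norm_nonneg _) (by positivity)
    rw [Matrix.frobenius_norm_transpose]
    exact mul_le_mul hB hR (norm_nonneg _) hβ
  have e : Aᵀ * N * A - A'ᵀ * N' * A'
      = (A - A')ᵀ * N * A + A'ᵀ * (N - N') * A + A'ᵀ * N' * (A - A') := by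
    simp only [Matrix.transpose_sub, Matrix.sub_mul, Matrix.mul_sub]
    abel
  rw [e]
  refine (norm_add₃_le).trans ?_
  have i1 := h3 (le_refl ‖A - A'‖) hA hN
  have i2 := h3 hA' hA (le_refl ‖N - N'‖)
  have i3 := h3 hA' (le_refl ‖A - A'‖) hN'
  linarith

variable [DecidableEq p]

/-- The quadratic cost from time `t` on, with running kernel `K` and terminal weight `G`, along
`X' = a X` and with output `V X`. -/
def cost (T : ℝ) (a : ℝ → Matrix p p ℝ) (V : ℝ → Matrix ι p ℝ) (G : ℝ → Matrix p p ℝ)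
    (K : ℝ → ℝ → Matrix ι ι ℝ) (t : ℝ) : Matrix p p ℝ :=
  (fundSolInv T a t)ᵀ * (G t + ∫ s in t..T, (V s * fundSol T a s)ᵀ * K t s * (V s * fundSol T a s))
    * fundSolInv T a t

lemma cost_posSemidef {a : ℝ → Matrix p p ℝ} {V : ℝ → Matrix ι p ℝ} {G : ℝ → Matrix p p ℝ} {t : ℝ}
    (ht : t ≤ T) (hG : (G t).PosSemidef) (hK : ∀ s ∈ Icc t T, (K t s).PosSemidef) :
    (cost T a V G K t).PosSemidef :=
  posSemidef_sandwich (hG.add (posSemidef_integral ht fun s hs =>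
    posSemidef_sandwich (hK s hs) _)) _

lemma memLp_output (hT : 0 ≤ T) {a : ℝ → Matrix p p ℝ} (ha : IntegrableOn a (Icc 0 T))
    {V : ℝ → Matrix ι p ℝ} (hV : MemLp V ⊤ (volume.restrict (Icc 0 T))) :
    MemLp (fun s => V s * fundSol T a s) ⊤ (volume.restrict (Icc 0 T)) :=
  hV.mmul (Q := ⊤)
    (memLp_top_of_continuousOn isCompact_Icc (fundSol_isPrimitive hT ha).continuousOn)

/-- The cost solves a linear backward (Lyapunov) equation. -/
lemma cost_isPrimitive (hT : 0 ≤ T) {a : ℝ → Matrix p p ℝ} (ha : IntegrableOn a (Icc 0 T))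
    {V : ℝ → Matrix ι p ℝ} (hV : MemLp V ⊤ (volume.restrict (Icc 0 T)))
    {G Gd : ℝ → Matrix p p ℝ} (hG : IsPrimitive 0 T G Gd) (hK : IsC1Kernel T K Kt) :
    IsPrimitive 0 T (cost T a V G K) (fun t =>
      -((a t)ᵀ * cost T a V G K t + cost T a V G K t * a t
        + ((V t)ᵀ * K t t * V t - cost T a V Gd Kt t))) := by
  have hY := fundSolInv_isPrimitive hT ha
  have hN := hG.add (hK.isPrimitive hT (memLp_output hT ha hV))
  -- The cost is `Yᵀ N Y`, with all dependence on `s > t` collected in the primitive `N`. The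
  -- product rule with `Y' = -Y a` gives the Lyapunov terms; `N'` gives the boundary term, where `X
  -- Y = 1` removes the fundamental matrices, and the cost with data `Gd`, `Kt`.
  refine ((hY.transpose.mul hN).mul hY).congr fun t ht => ?_
  have hXY := fundSol_mul_fundSolInv hT ha ht
  have h1 : (fundSolInv T a t)ᵀ * ((V t * fundSol T a t)ᵀ * K t t * (V t * fundSol T a t))
      * fundSolInv T a t = (V t)ᵀ * K t t * V t := by
    have h2 : (fundSolInv T a t)ᵀ * (fundSol T a t)ᵀ = 1 := by
      rw [← Matrix.transpose_mul, hXY, Matrix.transpose_one]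
    calc _ = ((fundSolInv T a t)ᵀ * (fundSol T a t)ᵀ) * ((V t)ᵀ * K t t * V t)
          * (fundSol T a t * fundSolInv T a t) := by
          simp only [Matrix.transpose_mul, Matrix.mul_assoc]
      _ = _ := by rw [h2, hXY, Matrix.one_mul, Matrix.mul_one]
  rw [← h1]
  simp only [cost]
  generalize (∫ s in t..T, (V s * fundSol T a s)ᵀ * K t s * (V s * fundSol T a s)) = I1
  generalize (∫ s in t..T, (V s * fundSol T a s)ᵀ * Kt t s * (V s * fundSol T a s)) = I2
  generalize (V t * fundSol T a t)ᵀ * K t t * (V t * fundSol T a t) = I3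
  simp only [Matrix.transpose_neg, Matrix.transpose_mul]
  noncomm_ring

lemma cost_right (hT : 0 ≤ T) {a : ℝ → Matrix p p ℝ} (ha : IntegrableOn a (Icc 0 T))
    {V : ℝ → Matrix ι p ℝ} {G : ℝ → Matrix p p ℝ} : cost T a V G K T = G T := by
  simp [cost, fundSolInv_right hT ha]

end Cost

lemma integral_le_of_ae {f g : ℝ → ℝ} {T t : ℝ} (hf : IntegrableOn f (Icc 0 T))
    (hg : IntegrableOn g (Icc 0 T)) (ht : t ∈ Icc 0 T)
    (h : ∀ᵐ s ∂volume.restrict (Icc 0 T), s ∈ Icc t T → f s ≤ g s) :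
    ∫ s in t..T, f s ≤ ∫ s in t..T, g s := by
  have hTm : T ∈ Icc 0 T := right_mem_Icc.2 (ht.1.trans ht.2)
  refine intervalIntegral.integral_mono_ae_restrict ht.2 (intervalIntegrable_sub hf ht hTm)
    (intervalIntegrable_sub hg ht hTm) ?_
  have hsub : Icc t T ⊆ Icc 0 T := Icc_subset_Icc_left ht.1
  have h1 := ae_restrict_of_ae_restrict_of_subset hsub h
  filter_upwards [h1, ae_restrict_mem measurableSet_Icc] with s hs hm using hs hm

/-- The cost depends on the feedback in a causal and Lipschitz way. -/
lemma exists_cost_lipschitz {p ι : Type*} [Fintype p] [Fintype ι] [DecidableEq p] {T : ℝ}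
    (hT : 0 ≤ T) {K : ℝ → ℝ → Matrix ι ι ℝ} {G : ℝ → Matrix p p ℝ}
    (hK : ContinuousOn (fun z : ℝ × ℝ => K z.1 z.2) (Icc 0 T ×ˢ Icc 0 T))
    (hG : ContinuousOn G (Icc 0 T)) (L v β : ℝ) (hv : 0 ≤ v) (hβ : 0 ≤ β) :
    ∃ C, 0 ≤ C ∧ ∀ (a a' : ℝ → Matrix p p ℝ) (V V' : ℝ → Matrix ι p ℝ) (δ : ℝ → ℝ),
      IntegrableOn a (Icc 0 T) → IntegrableOn a' (Icc 0 T) →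
      ∫ s in 0..T, ‖a s‖ ≤ L → ∫ s in 0..T, ‖a' s‖ ≤ L →
      MemLp V ⊤ (volume.restrict (Icc 0 T)) → MemLp V' ⊤ (volume.restrict (Icc 0 T)) →
      (∀ᵐ s ∂volume.restrict (Icc 0 T), ‖V s‖ ≤ v) →
      (∀ᵐ s ∂volume.restrict (Icc 0 T), ‖V' s‖ ≤ v) →
      IntegrableOn δ (Icc 0 T) → (∀ s, 0 ≤ δ s) →
      (∀ᵐ s ∂volume.restrict (Icc 0 T), ‖a s - a' s‖ ≤ β * δ s) →
      (∀ᵐ s ∂volume.restrict (Icc 0 T), ‖V s - V' s‖ ≤ δ s) →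
      ∀ t ∈ Icc 0 T, ‖cost T a V G K t - cost T a' V' G K t‖ ≤ C * ∫ s in t..T, δ s := by
  obtain ⟨κ, hκ⟩ := (isCompact_Icc.prod isCompact_Icc).exists_bound_of_continuousOn hK
  obtain ⟨g, hg⟩ := isCompact_Icc.exists_bound_of_continuousOn hG
  have h0 : (0 : ℝ) ∈ Icc 0 T := left_mem_Icc.2 hT
  have hTm : T ∈ Icc 0 T := right_mem_Icc.2 hT
  have hκ0 : 0 ≤ κ := (norm_nonneg _).trans (hκ (0, 0) ⟨h0, h0⟩)
  have hg0 : 0 ≤ g := (norm_nonneg _).trans (hg 0 h0)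
  -- With `D = ∫_t^T δ`: `x` bounds `X` and `Y`, `d D` bounds their variation, `ν` bounds the middle
  -- factor of the cost and `c D` its variation.
  set x := 2 * ‖(1 : Matrix p p ℝ)‖ * Real.exp (2 * L) with hx
  set d := 4 * ‖(1 : Matrix p p ℝ)‖ * Real.exp (2 * L) ^ 2 * β with hd
  have hx0 : 0 ≤ x := by positivity
  have hd0 : 0 ≤ d := by positivity
  set ν := g + κ * (v * x) ^ 2 * T with hν
  have hν0 : 0 ≤ ν := by positivity
  set c := 2 * (v * x) * κ * (x + v * d * T) with hc
  have hc0 : 0 ≤ c := by positivity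
  refine ⟨2 * x * ν * d + x ^ 2 * c, by positivity, ?_⟩
  intro a a' V V' δ ha ha' hL hL' hV hV' hVv hVv' hδ hδ0 haa hVV t ht
  set D := ∫ s in t..T, δ s with hD
  have hD0 : 0 ≤ D := tail_nonneg hδ0 ht.2
  have hdiff : ∀ s ∈ Icc t T, ∫ r in s..T, ‖a r - a' r‖ ≤ β * D := by
    intro s hs
    have hs' : s ∈ Icc 0 T := ⟨ht.1.trans hs.1, hs.2⟩
    calc ∫ r in s..T, ‖a r - a' r‖ ≤ ∫ r in s..T, β * δ r :=
          integral_le_of_ae (ha.sub ha').norm (hδ.const_mul β) hs'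
            (haa.mono fun r hr _ => hr)
      _ = β * ∫ r in s..T, δ r := intervalIntegral.integral_const_mul _ _
      _ ≤ β * D := mul_le_mul_of_nonneg_left (tail_antitone hδ hδ0 ht hs' hs.1) hβ
  have hXd : ∀ s ∈ Icc t T, ‖fundSol T a s - fundSol T a' s‖ ≤ d * D := by
    intro s hs
    have hs' : s ∈ Icc 0 T := ⟨ht.1.trans hs.1, hs.2⟩
    refine (fundSol_sub_le hT ha ha' hL hL' hs').trans ?_
    rw [hd, mul_assoc _ β]
    exact mul_le_mul_of_nonneg_left (hdiff s hs) (by positivity)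
  have hYd : ‖fundSolInv T a t - fundSolInv T a' t‖ ≤ d * D := by
    refine (fundSolInv_sub_le hT ha ha' hL hL' ht).trans ?_
    rw [hd, mul_assoc _ β]
    exact mul_le_mul_of_nonneg_left (hdiff t (left_mem_Icc.2 ht.2)) (by positivity)
  have hKt := continuousOn_section hK ht
  -- bounds for the integral term
  have hint : ∀ {a : ℝ → Matrix p p ℝ} {V : ℝ → Matrix ι p ℝ}, IntegrableOn a (Icc 0 T) →
      MemLp V ⊤ (volume.restrict (Icc 0 T)) → IntegrableOn (fun s =>
        (V s * fundSol T a s)ᵀ * K t s * (V s * fundSol T a s)) (Icc 0 T) :=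
    fun ha hV => integrableOn_sandwich (memLp_output hT ha hV) hKt
  have hZ : ∀ {a : ℝ → Matrix p p ℝ} {V : ℝ → Matrix ι p ℝ}, IntegrableOn a (Icc 0 T) →
      ∫ s in 0..T, ‖a s‖ ≤ L → ∀ {s}, s ∈ Icc 0 T → ‖V s‖ ≤ v →
      ‖V s * fundSol T a s‖ ≤ v * x := fun ha hL s hs hVs =>
    (Matrix.frobenius_norm_mul _ _).trans
      (mul_le_mul hVs (fundSol_norm_le hT ha hL hs) (norm_nonneg _) hv)
  have hN : ∀ {a : ℝ → Matrix p p ℝ} {V : ℝ → Matrix ι p ℝ}, IntegrableOn a (Icc 0 T) →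
      ∫ s in 0..T, ‖a s‖ ≤ L → MemLp V ⊤ (volume.restrict (Icc 0 T)) →
      (∀ᵐ s ∂volume.restrict (Icc 0 T), ‖V s‖ ≤ v) →
      ‖G t + ∫ s in t..T, (V s * fundSol T a s)ᵀ * K t s * (V s * fundSol T a s)‖ ≤ ν := by
    intro a V ha hL hV hVv
    refine (norm_add_le _ _).trans (add_le_add (hg t ht) ?_)
    refine (intervalIntegral.norm_integral_le_integral_norm ht.2).trans ?_
    calc _ ≤ ∫ s in t..T, κ * (v * x) ^ 2 := by
          refine integral_le_of_ae (hint ha hV).norm (integrableOn_const (by simp)) ht ?_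
          filter_upwards [hVv, ae_restrict_mem measurableSet_Icc] with s hs hm _
          have h1 := hZ ha hL hm hs
          refine (Matrix.frobenius_norm_mul _ _).trans ?_
          refine (mul_le_mul_of_nonneg_right (Matrix.frobenius_norm_mul _ _)
            (norm_nonneg _)).trans ?_
          rw [Matrix.frobenius_norm_transpose]
          have h2 := hκ (t, s) ⟨ht, hm⟩
          calc ‖V s * fundSol T a s‖ * ‖K t s‖ * ‖V s * fundSol T a s‖
              ≤ (v * x) * κ * (v * x) := by gcongr
            _ = κ * (v * x) ^ 2 := by ring
      _ = κ * (v * x) ^ 2 * (T - t) := by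
          rw [intervalIntegral.integral_const, smul_eq_mul, mul_comm]
      _ ≤ κ * (v * x) ^ 2 * T := by
          have := ht.1
          gcongr
          linarith
  have hNd : ‖(G t + ∫ s in t..T, (V s * fundSol T a s)ᵀ * K t s * (V s * fundSol T a s))
      - (G t + ∫ s in t..T, (V' s * fundSol T a' s)ᵀ * K t s * (V' s * fundSol T a' s))‖
      ≤ c * D := by
    rw [add_sub_add_left_eq_sub, ← intervalIntegral.integral_sub
      (intervalIntegrable_sub (hint ha hV) ht hTm) (intervalIntegrable_sub (hint ha' hV') ht hTm)]
    refine (intervalIntegral.norm_integral_le_integral_norm ht.2).trans ?_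
    calc _ ≤ ∫ s in t..T, 2 * (v * x) * κ * (x * δ s + v * (d * D)) := by
          refine integral_le_of_ae ((hint ha hV).sub (hint ha' hV')).norm
            (((hδ.const_mul x).add (integrableOn_const (by simp))).const_mul _) ht ?_
          filter_upwards [hVv, hVv', hVV, ae_restrict_mem measurableSet_Icc]
            with s hs hs' hss hm hst
          have h1 := norm_sandwich_sub_le (hZ ha hL hm hs) (hZ ha' hL' hm hs')
            (hκ (t, s) ⟨ht, hm⟩) (hκ (t, s) ⟨ht, hm⟩)
          rw [sub_self, norm_zero, mul_zero, add_zero] at h1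
          refine h1.trans (mul_le_mul_of_nonneg_left ?_ (by positivity))
          have e : V s * fundSol T a s - V' s * fundSol T a' s
              = (V s - V' s) * fundSol T a s + V' s * (fundSol T a s - fundSol T a' s) := by
            rw [Matrix.sub_mul, Matrix.mul_sub]; abel
          rw [e]
          refine (norm_add_le _ _).trans (add_le_add ?_ ?_)
          · refine (Matrix.frobenius_norm_mul _ _).trans ?_
            rw [mul_comm x]
            exact mul_le_mul hss (fundSol_norm_le hT ha hL hm) (norm_nonneg _) (hδ0 s)
          · exact (Matrix.frobenius_norm_mul _ _).trans
              (mul_le_mul hs' (hXd s hst) (norm_nonneg _) hv)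
      _ = 2 * (v * x) * κ * (x * D + v * (d * D) * (T - t)) := by
          rw [intervalIntegral.integral_const_mul, intervalIntegral.integral_add
            ((intervalIntegrable_sub hδ ht hTm).const_mul x) intervalIntegrable_const,
            intervalIntegral.integral_const_mul, intervalIntegral.integral_const, smul_eq_mul]
          ring
      _ ≤ 2 * (v * x) * κ * (x * D + v * (d * D) * T) := by
          have := ht.1
          gcongr
          linarith
      _ = c * D := by rw [hc]; ring
  refine (norm_sandwich_sub_le (fundSolInv_norm_le hT ha hL ht) (fundSolInv_norm_le hT ha' hL' ht)
    (hN ha hL hV hVv) (hN ha' hL' hV' hVv')).trans ?_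
  calc _ ≤ 2 * x * ν * (d * D) + x ^ 2 * (c * D) := by gcongr
    _ = _ := by ring

/-! ### Continuously differentiable coefficients -/

lemma integral_derivWithin_Icc {T : ℝ} {g : ℝ → ℝ} (hg : ContDiffOn ℝ 1 g (Icc 0 T))
    (hT : 0 < T) {a b : ℝ} (ha : 0 ≤ a) (hab : a ≤ b) (hb : b ≤ T) :
    ∫ r in a..b, derivWithin g (Icc 0 T) r = g b - g a := by
  have hsub : Icc a b ⊆ Icc 0 T := Icc_subset_Icc ha hb
  have hc : ContinuousOn (derivWithin g (Icc 0 T)) (Icc 0 T) :=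
    hg.continuousOn_derivWithin (uniqueDiffOn_Icc hT) le_rfl
  refine intervalIntegral.integral_eq_sub_of_hasDerivAt_of_le hab (hg.continuousOn.mono hsub)
    (fun x hx => ?_) ?_
  · have hx' : x ∈ Icc 0 T := hsub (Ioo_subset_Icc_self hx)
    exact ((hg.differentiableOn one_ne_zero x hx').hasDerivWithinAt).hasDerivAt
      (Icc_mem_nhds (ha.trans_lt hx.1) (hx.2.trans_le hb))
  · exact (hc.mono (by rwa [uIcc_of_le hab])).intervalIntegrable

/-- The partial derivative is the total derivative within the square, applied to `(1, 0)`. -/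
lemma continuousOn_derivWithin_fst {T : ℝ} (hT : 0 < T) {f : ℝ → ℝ → ℝ}
    (hf : ContDiffOn ℝ 1 (fun z : ℝ × ℝ => f z.1 z.2) (Icc 0 T ×ˢ Icc 0 T)) :
    ContinuousOn (fun z : ℝ × ℝ => derivWithin (fun r => f r z.2) (Icc 0 T) z.1)
      (Icc 0 T ×ˢ Icc 0 T) := by
  have hu : UniqueDiffOn ℝ (Icc 0 T) := uniqueDiffOn_Icc hT
  have hc := hf.continuousOn_fderivWithin (hu.prod hu) le_rfl
  have hc2 := hc.clm_apply (continuousOn_const (c := ((1 : ℝ), (0 : ℝ))))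
  refine hc2.congr fun z hz => ?_
  have h1 := (hf.differentiableOn one_ne_zero z hz).hasFDerivWithinAt
  have h2 : HasDerivWithinAt (fun r : ℝ => (r, z.2)) ((1 : ℝ), (0 : ℝ)) (Icc 0 T) z.1 :=
    (hasDerivWithinAt_id _ _).prodMk (hasDerivWithinAt_const _ _ _)
  have h3 := h1.comp_hasDerivWithinAt z.1 h2
    (show MapsTo (fun r => (r, z.2)) (Icc 0 T) (Icc 0 T ×ˢ Icc 0 T) from fun r hr => ⟨hr, hz.2⟩)
  exact h3.derivWithin (hu z.1 hz.1)

lemma contDiffOn_section_fst {T : ℝ} {f : ℝ → ℝ → ℝ}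
    (hf : ContDiffOn ℝ 1 (fun z : ℝ × ℝ => f z.1 z.2) (Icc 0 T ×ˢ Icc 0 T)) {s : ℝ}
    (hs : s ∈ Icc 0 T) : ContDiffOn ℝ 1 (fun r => f r s) (Icc 0 T) :=
  hf.comp (f := fun r => (r, s)) (by fun_prop) fun _ hr => ⟨hr, hs⟩

lemma IsC1.isPrimitive {T : ℝ} (hT : 0 < T) {p q : ℕ} {F : ℝ → Matrix (Fin p) (Fin q) ℝ}
    (hF : IsC1 T F) : IsPrimitive 0 T F (dot T F) := by
  refine IsPrimitive.of_entries fun i j => ⟨?_, fun t ht => ?_⟩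
  · exact ((hF i j).continuousOn_derivWithin (uniqueDiffOn_Icc hT)
      le_rfl).integrableOn_compact isCompact_Icc
  · have := integral_derivWithin_Icc (hF i j) hT ht.1 ht.2 le_rfl
    simp only [dot, Matrix.of_apply]
    rw [this]
    ring

/-! ### Block kernels of the running cost and their positivity. -/

namespace Coeffs

variable {n m : ℕ} (c : Coeffs n m)

/-- The block matrix of the running cost. -/
def kernel (t s : ℝ) : Matrix (Fin n ⊕ Fin m) (Fin n ⊕ Fin m) ℝ :=
  Matrix.fromBlocks (c.Q t s) (c.S t s)ᵀ (c.S t s) (c.M t s)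

/-- The partial derivative of the running cost in its first variable. -/
def kernelDeriv (T t s : ℝ) : Matrix (Fin n ⊕ Fin m) (Fin n ⊕ Fin m) ℝ :=
  Matrix.fromBlocks (dfst T c.Q t s) (dfst T c.S t s)ᵀ (dfst T c.S t s) (dfst T c.M t s)

variable {c} {T : ℝ}

lemma kernel_isC1Kernel (hT : 0 < T) (h2 : H2 T c) (h3 : H3 T c) (h4 : H4 T c) :
    IsC1Kernel T c.kernel (c.kernelDeriv T) := by
  have hcd : ∀ i j, ContDiffOn ℝ 1 (fun z : ℝ × ℝ => c.kernel z.1 z.2 i j)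
      (Icc 0 T ×ˢ Icc 0 T) := by
    rintro (i | i) (j | j)
    exacts [h3.Q_C1 i j, h4.S_C1 j i, h4.S_C1 i j, h2.M_C1 i j]
  have hder : ∀ t s i j, c.kernelDeriv T t s i j
      = derivWithin (fun r => c.kernel r s i j) (Icc 0 T) t := by
    rintro t s (i | i) (j | j) <;> rfl
  have hct : ContinuousOn (fun z : ℝ × ℝ => c.kernelDeriv T z.1 z.2) (Icc 0 T ×ˢ Icc 0 T) := by
    refine continuousOn_matrix.2 fun i j => ?_
    simp only [hder]
    exact continuousOn_derivWithin_fst hT (f := fun r s => c.kernel r s i j) (hcd i j)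
  refine ⟨continuousOn_matrix.2 fun i j => (hcd i j).continuousOn, hct, fun t s h0 hts hs => ?_⟩
  have hs' : s ∈ Icc 0 T := ⟨h0.trans hts, hs⟩
  have ht' : t ∈ Icc 0 T := ⟨h0, hts.trans hs⟩
  ext i j
  have h1 := (entryCLM i j).intervalIntegral_comp_comm (intervalIntegrable_sub
    ((continuousOn_section_fst hct hs').integrableOn_compact isCompact_Icc) ht' hs')
  simp only [entryCLM_apply, hder] at h1
  rw [Matrix.sub_apply, ← h1, integral_derivWithin_Icc
    (contDiffOn_section_fst (f := fun r s => c.kernel r s i j) (hcd i j) hs') hT h0 hts hs]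
  ring

/-- Schur complement criterion with respect to the invertible block `M`. -/
lemma kernel_posSemidef (h2 : H2 T c) (h5 : H5 T c) {t s : ℝ} (h0 : 0 ≤ t) (hts : t ≤ s)
    (hs : s ≤ T) : (c.kernel t s).PosSemidef := by
  have hM := h2.M_pos t ⟨h0, hts.trans hs⟩ s ⟨h0.trans hts, hs⟩
  have : Invertible (c.M t s) := hM.isUnit.invertible
  have h := (Matrix.PosDef.fromBlocks₂₂ (c.Q t s) (c.S t s)ᵀ hM).2
    (by simpa using h5.schur_nonneg t s h0 hts hs)
  simpa [kernel] using h

/-- Since `M_t` may be singular, the Schur decomposition is written out with `L` in place of `M_t⁻¹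
S_t`: the block matrix equals `[1 0]ᵀ (Q_t - S_tᵀ L) [1 0] + [L 1]ᵀ M_t [L 1]`. -/
lemma kernelDeriv_posSemidef (h5 : H5 T c) {t s : ℝ} (h0 : 0 ≤ t) (hts : t ≤ s)
    (hs : s ≤ T) : (c.kernelDeriv T t s).PosSemidef := by
  obtain ⟨L, hL, hpos⟩ := h5.schur_t_nonneg t s h0 hts hs
  have hM := h5.Mt_nonneg t s h0 hts hs
  have hMs : (dfst T c.M t s)ᵀ = dfst T c.M t s := by
    have := hM.1
    rwa [Matrix.IsHermitian, Matrix.conjTranspose_eq_transpose_of_trivial] at this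
  have h1 := posSemidef_sandwich hpos
    (Matrix.fromCols (1 : Matrix (Fin n) (Fin n) ℝ) (0 : Matrix (Fin n) (Fin m) ℝ))
  have h2 := posSemidef_sandwich hM (Matrix.fromCols L (1 : Matrix (Fin m) (Fin m) ℝ))
  have h3 := h1.add h2
  convert h3 using 1
  have e : Lᵀ * dfst T c.M t s = (dfst T c.S t s)ᵀ := by
    rw [← hL, Matrix.transpose_mul, hMs]
  have block : ∀ {l : ℕ} (A : Matrix (Fin n) (Fin l) ℝ) (B : Matrix (Fin m) (Fin l) ℝ)
      (N : Matrix (Fin l) (Fin l) ℝ) (C : Matrix (Fin l) (Fin n) ℝ) (D : Matrix (Fin l) (Fin m) ℝ),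
      Matrix.fromRows A B * N * Matrix.fromCols C D
        = Matrix.fromBlocks (A * N * C) (A * N * D) (B * N * C) (B * N * D) := by
    intro l A B N C D
    rw [Matrix.fromRows_mul, Matrix.fromRows_mul_fromCols]
  rw [Matrix.transpose_fromCols, Matrix.transpose_fromCols, block, block,
    Matrix.fromBlocks_add, kernelDeriv]
  simp [e, hL]

end Coeffs

/-! ### Outputs of a feedback law -/

section Output

variable {n m : Type*} [Fintype n] [Fintype m]

lemma frobenius_norm_sq {p q : Type*} [Fintype p] [Fintype q] (A : Matrix p q ℝ) :
    ‖A‖ ^ 2 = ∑ i, ∑ j, A i j ^ 2 := by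
  rw [Matrix.frobenius_norm_def, ← Real.sqrt_eq_rpow, Real.sq_sqrt (by positivity)]
  simp

lemma norm_fromRows_sq (A : Matrix n n ℝ) (B : Matrix m n ℝ) :
    ‖Matrix.fromRows A B‖ ^ 2 = ‖A‖ ^ 2 + ‖B‖ ^ 2 := by
  simp [frobenius_norm_sq, Fintype.sum_sum_type]

variable [DecidableEq n]

/-- The map from states to state-control pairs under the feedback `u = - U x`. -/
def output (U : ℝ → Matrix m n ℝ) (s : ℝ) : Matrix (n ⊕ m) n ℝ :=
  Matrix.fromRows 1 (-(U s))

lemma norm_output_sub (U U' : ℝ → Matrix m n ℝ) (s : ℝ) :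
    ‖output U s - output U' s‖ = ‖U s - U' s‖ := by
  have e : output U s - output U' s = Matrix.fromRows 0 (-(U s - U' s)) := by
    ext (i | i) j
    · simp [output]
    · simp [output]; ring
  have h := norm_fromRows_sq (0 : Matrix n n ℝ) (-(U s - U' s))
  rw [← e, norm_zero, norm_neg] at h
  exact (pow_left_inj₀ (norm_nonneg _) (norm_nonneg _) two_ne_zero).1 (by simpa using h)

lemma norm_output_le (U : ℝ → Matrix m n ℝ) (s : ℝ) :
    ‖output U s‖ ≤ ‖(1 : Matrix n n ℝ)‖ + ‖U s‖ := by
  have h := norm_fromRows_sq (1 : Matrix n n ℝ) (-(U s))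
  rw [norm_neg] at h
  refine (pow_le_pow_iff_left₀ (norm_nonneg _) (by positivity) two_ne_zero).1 ?_
  rw [output, h]
  nlinarith [norm_nonneg (1 : Matrix n n ℝ), norm_nonneg (U s)]

lemma memLp_outputMap {T : ℝ} {U : ℝ → Matrix m n ℝ}
    (hU : MemLp U ⊤ (volume.restrict (Icc 0 T))) :
    MemLp (output U) ⊤ (volume.restrict (Icc 0 T)) := by
  refine memLp_matrix.2 ?_
  rintro (i | i) j
  · exact memLp_const _
  · exact (memLp_matrix.1 hU i j).neg

/-- Matches the block form of the cost with the expressions in `Υ` that occur in `Q̄` and in the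
completed square. -/
lemma output_sandwich (U : ℝ → Matrix m n ℝ) (s : ℝ) (Q : Matrix n n ℝ) (S : Matrix m n ℝ)
    (M : Matrix m m ℝ) :
    (output U s)ᵀ * Matrix.fromBlocks Q Sᵀ S M * output U s
      = Q + ((U s)ᵀ * M * U s - (U s)ᵀ * S - Sᵀ * U s) := by
  rw [output, Matrix.transpose_fromRows, Matrix.fromCols_mul_fromBlocks,
    Matrix.fromCols_mul_fromRows]
  simp only [Matrix.transpose_one, Matrix.one_mul, Matrix.mul_one, Matrix.transpose_neg,
    Matrix.neg_mul, Matrix.mul_neg, Matrix.add_mul]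
  abel

end Output

/-! ### The equilibrium Riccati equation as a fixed-point equation -/

lemma IsC1Sq.continuousOn {T : ℝ} {p q : ℕ} {F : ℝ → ℝ → Matrix (Fin p) (Fin q) ℝ}
    (hF : IsC1Sq T F) : ContinuousOn (fun z : ℝ × ℝ => F z.1 z.2) (Icc 0 T ×ˢ Icc 0 T) :=
  continuousOn_matrix.2 fun i j => (hF i j).continuousOn

lemma IsC1Sq.continuousOn_diag {T : ℝ} {p q : ℕ} {F : ℝ → ℝ → Matrix (Fin p) (Fin q) ℝ}
    (hF : IsC1Sq T F) : ContinuousOn (fun t => F t t) (Icc 0 T) :=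
  hF.continuousOn.comp (f := fun t => (t, t)) (by fun_prop) fun _ ht => ⟨ht, ht⟩

lemma transpose_eq_of_posSemidef {p : Type*} {A : Matrix p p ℝ} (hA : A.PosSemidef) : Aᵀ = A := by
  have := hA.1
  rwa [Matrix.IsHermitian, Matrix.conjTranspose_eq_transpose_of_trivial] at this

/-- Completion of the square in the Riccati equation. -/
lemma riccati_completion {n m : ℕ} {A P Q : Matrix (Fin n) (Fin n) ℝ}
    {B : Matrix (Fin n) (Fin m) ℝ} {S U : Matrix (Fin m) (Fin n) ℝ}
    {M : Matrix (Fin m) (Fin m) ℝ} (hU : M * U = Bᵀ * P + S) :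
    Aᵀ * P + P * A + Q - (P * B + Sᵀ) * U
      = (A - B * U)ᵀ * P + P * (A - B * U) + (Q + (Uᵀ * M * U - Uᵀ * S - Sᵀ * U)) := by
  rw [Matrix.mul_assoc Uᵀ, hU, Matrix.transpose_sub, Matrix.transpose_mul]
  simp only [Matrix.mul_add, Matrix.add_mul, Matrix.mul_sub, Matrix.sub_mul, Matrix.mul_assoc]
  abel

namespace Coeffs

variable {n m : ℕ} (c : Coeffs n m)

/-- The cost-to-go matrix under the feedback determined by `P`. -/
def value (T : ℝ) (P : ℝ → Matrix (Fin n) (Fin n) ℝ) : ℝ → Matrix (Fin n) (Fin n) ℝ :=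
  cost T (c.closedLoop P) (output (c.Upsilon P)) c.G c.kernel

/-- The sensitivity of the cost with respect to the evaluation time. -/
def drift (T : ℝ) (P : ℝ → Matrix (Fin n) (Fin n) ℝ) : ℝ → Matrix (Fin n) (Fin n) ℝ :=
  cost T (c.closedLoop P) (output (c.Upsilon P)) (dot T c.G) (c.kernelDeriv T)

variable {c} {T : ℝ}

lemma continuousOn_inv (h2 : H2 T c) : ContinuousOn (fun s => (c.M s s)⁻¹) (Icc 0 T) := by
  have hM := h2.M_C1.continuousOn_diag
  have hdet : ContinuousOn (fun s => (c.M s s).det) (Icc 0 T) :=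
    (Continuous.matrix_det continuous_id).comp_continuousOn hM
  have hadj : ContinuousOn (fun s => (c.M s s).adjugate) (Icc 0 T) :=
    (Continuous.matrix_adjugate continuous_id).comp_continuousOn hM
  refine ((hdet.inv₀ fun s hs => (h2.M_pos s hs s hs).det_pos.ne').smul hadj).congr fun s _ => ?_
  rw [Matrix.inv_def, Ring.inverse_eq_inv']
  rfl

lemma integrableOn_A (h1 : H1 T c) : IntegrableOn c.A (Icc 0 T) :=
  memLp_one_iff_integrable.1 (memLp_matrix.2 h1.A_mem)

lemma memLp_B (h1 : H1 T c) : MemLp c.B ⊤ (volume.restrict (Icc 0 T)) :=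
  memLp_matrix.2 h1.B_mem

section

variable (h1 : H1 T c) (h2 : H2 T c) (h4 : H4 T c) {P : ℝ → Matrix (Fin n) (Fin n) ℝ}
  (hP : ContinuousOn P (Icc 0 T))

include h1 h2 h4 hP

lemma memLp_Upsilon : MemLp (c.Upsilon P) ⊤ (volume.restrict (Icc 0 T)) := by
  have hN := memLp_top_of_continuousOn (ν := volume) isCompact_Icc (continuousOn_inv h2)
  have hP' := memLp_top_of_continuousOn (ν := volume) isCompact_Icc hP
  have hS := memLp_top_of_continuousOn (ν := volume) isCompact_Icc h4.S_C1.continuousOn_diag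
  exact hN.mmul (Q := ⊤) ((MemLp.mmul (P := ⊤) (Q := ⊤) (memLp_B h1).mtranspose hP').add hS)

lemma integrableOn_closedLoop : IntegrableOn (c.closedLoop P) (Icc 0 T) :=
  (integrableOn_A h1).sub (((memLp_B h1).mmul (Q := ⊤) (R := ⊤)
    (memLp_Upsilon h1 h2 h4 hP)).integrable le_top)

variable (hT : 0 < T)

include hT

lemma value_right : c.value T P T = c.G T :=
  cost_right hT.le (integrableOn_closedLoop h1 h2 h4 hP)

variable (h3 : H3 T c)

include h3

lemma value_isPrimitive : IsPrimitive 0 T (c.value T P) (fun t =>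
    -((c.closedLoop P t)ᵀ * c.value T P t + c.value T P t * c.closedLoop P t
      + ((output (c.Upsilon P) t)ᵀ * c.kernel t t * output (c.Upsilon P) t - c.drift T P t))) :=
  cost_isPrimitive hT.le (integrableOn_closedLoop h1 h2 h4 hP)
    (memLp_outputMap (memLp_Upsilon h1 h2 h4 hP)) (h3.G_C1.isPrimitive hT)
    (kernel_isC1Kernel hT h2 h3 h4)

/-- The terms subtracted in `Q̄` form the cost with data `Ġ` and `K_t`: insert `Φ(s,t) = X(s) Y(t)`
and merge the two integrals into one with the block kernel. -/
lemma Qbar_eq {Φ : ℝ → ℝ → Matrix (Fin n) (Fin n) ℝ} (hΦ : IsTransition T (c.closedLoop P) Φ)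
    {t : ℝ} (ht : t ∈ Icc 0 T) : c.Qbar T P Φ t = c.Q t t - c.drift T P t := by
  have ha := integrableOn_closedLoop h1 h2 h4 hP
  have hV := memLp_outputMap (memLp_Upsilon h1 h2 h4 hP)
  have hK := kernel_isC1Kernel hT h2 h3 h4
  have hTm : T ∈ Icc 0 T := right_mem_Icc.2 hT.le
  have hXc := (fundSol_isPrimitive hT.le ha).continuousOn
  have hΦe : ∀ s ∈ Icc 0 T, Φ s t
      = fundSol T (c.closedLoop P) s * fundSolInv T (c.closedLoop P) t :=
    fun s hs => hΦ.eq_fundSol hT.le ha hs ht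
  have hΦc : ContinuousOn (fun s => Φ s t) (Icc 0 T) :=
    (hXc.mmul continuousOn_const).congr hΦe
  have hΦT : Φ T t = fundSolInv T (c.closedLoop P) t := by
    rw [hΦe T hTm, fundSol_right hT.le ha, Matrix.one_mul]
  have hKc := continuousOn_section hK.cont_t ht
  have hQc : ContinuousOn (fun s => dfst T c.Q t s) (Icc 0 T) :=
    continuousOn_matrix.2 fun i j => continuousOn_matrix.1 hKc (Sum.inl i) (Sum.inl j)
  set U := c.Upsilon P with hU
  have hZ : MemLp (fun s => output U s * Φ s t) ⊤ (volume.restrict (Icc 0 T)) :=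
    hV.mmul (Q := ⊤) (memLp_top_of_continuousOn isCompact_Icc hΦc)
  have hI := integrableOn_sandwich hZ hKc
  have hI1 := integrableOn_sandwich
    (memLp_top_of_continuousOn (ν := volume) isCompact_Icc hΦc) hQc
  -- Writing the second integrand as a difference of two integrable functions makes the two
  -- entrywise integrals additive.
  have hsplit : ∀ s, (Φ s t)ᵀ * ((U s)ᵀ * dfst T c.M t s * U s - (U s)ᵀ * dfst T c.S t s
        - (dfst T c.S t s)ᵀ * U s) * Φ s t
      = (output U s * Φ s t)ᵀ * c.kernelDeriv T t s * (output U s * Φ s t)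
        - (Φ s t)ᵀ * dfst T c.Q t s * Φ s t := by
    intro s
    have h := output_sandwich U s (dfst T c.Q t s) (dfst T c.S t s) (dfst T c.M t s)
    have e : (output U s * Φ s t)ᵀ * c.kernelDeriv T t s * (output U s * Φ s t)
        = (Φ s t)ᵀ * ((output U s)ᵀ * c.kernelDeriv T t s * output U s) * Φ s t := by
      simp only [Matrix.transpose_mul, Matrix.mul_assoc]
    rw [e, kernelDeriv, h, Matrix.mul_add, Matrix.add_mul]
    abel
  have hi := intervalIntegrable_sub hI ht hTm
  have hi1 := intervalIntegrable_sub hI1 ht hTm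
  have hsum : matInt t T (fun s => (Φ s t)ᵀ * dfst T c.Q t s * Φ s t)
      + matInt t T (fun s => (Φ s t)ᵀ * ((U s)ᵀ * dfst T c.M t s * U s
        - (U s)ᵀ * dfst T c.S t s - (dfst T c.S t s)ᵀ * U s) * Φ s t)
      = ∫ s in t..T, (output U s * Φ s t)ᵀ * c.kernelDeriv T t s * (output U s * Φ s t) := by
    simp only [hsplit]
    rw [matInt_eq hi1, matInt_eq (hi.sub hi1), intervalIntegral.integral_sub hi hi1]
    abel
  have hI' := integrableOn_sandwich (memLp_output hT.le ha hV) hKc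
  have hcomm := (sandwichCLM (fundSolInv T (c.closedLoop P) t)ᵀ
    (fundSolInv T (c.closedLoop P) t)).intervalIntegral_comp_comm
      (intervalIntegrable_sub hI' ht hTm)
  simp only [sandwichCLM_apply] at hcomm
  have hfin : ∫ s in t..T, (output U s * Φ s t)ᵀ * c.kernelDeriv T t s * (output U s * Φ s t)
      = (fundSolInv T (c.closedLoop P) t)ᵀ * (∫ s in t..T,
        (output U s * fundSol T (c.closedLoop P) s)ᵀ * c.kernelDeriv T t s
          * (output U s * fundSol T (c.closedLoop P) s)) * fundSolInv T (c.closedLoop P) t := by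
    rw [← hcomm]
    refine intervalIntegral.integral_congr fun s hs => ?_
    rw [uIcc_of_le ht.2] at hs
    simp only [hΦe s ⟨ht.1.trans hs.1, hs.2⟩, Matrix.transpose_mul, Matrix.mul_assoc]
  rw [Qbar, sub_sub, hsum, hfin, hΦT, drift, cost, Matrix.mul_add, Matrix.add_mul]
  abel

/-- The right-hand side of the Riccati equation in closed-loop form. -/
lemma riccati_integrand_eq {Φ : ℝ → ℝ → Matrix (Fin n) (Fin n) ℝ}
    (hΦ : IsTransition T (c.closedLoop P) Φ) {s : ℝ} (hs : s ∈ Icc 0 T) :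
    (c.A s)ᵀ * P s + P s * c.A s + c.Qbar T P Φ s
        - (P s * c.B s + (c.S s s)ᵀ) * (c.M s s)⁻¹ * ((c.B s)ᵀ * P s + c.S s s)
      = (c.closedLoop P s)ᵀ * P s + P s * c.closedLoop P s
        + ((output (c.Upsilon P) s)ᵀ * c.kernel s s * output (c.Upsilon P) s
          - c.drift T P s) := by
  have hMu : IsUnit (c.M s s).det := (h2.M_pos s hs s hs).det_pos.ne'.isUnit
  have hU : c.M s s * c.Upsilon P s = (c.B s)ᵀ * P s + c.S s s := by
    rw [Upsilon, ← Matrix.mul_assoc, Matrix.mul_nonsing_inv _ hMu, Matrix.one_mul]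
  have h := riccati_completion (A := c.A s) (Q := c.Q s s) hU
  rw [Qbar_eq h1 h2 h4 hP hT h3 hΦ hs, kernel, output_sandwich, closedLoop,
    ← add_sub_assoc ((c.A s - _)ᵀ * P s + _), ← h, Matrix.mul_assoc, ← Upsilon]
  abel

/-- Replacing `value` by `P` in the Lyapunov equation of `value` gives the Riccati equation in
closed-loop form. -/
lemma isRiccatiSolution_of_eq_value (hsymm : ∀ t ∈ Icc 0 T, (P t).IsSymm)
    (h : ∀ t ∈ Icc 0 T, P t = c.value T P t) : IsRiccatiSolution T c P := by
  have hΦ := isTransition_fundSol hT.le (integrableOn_closedLoop h1 h2 h4 hP)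
  have hv := value_isPrimitive h1 h2 h4 hP hT h3
  have hTm : T ∈ Icc 0 T := right_mem_Icc.2 hT.le
  refine ⟨hP, hsymm, _, hΦ, fun t ht => ?_⟩
  rw [matInt_congr ht.2 fun s hs => riccati_integrand_eq h1 h2 h4 hP hT h3 hΦ
      ⟨ht.1.trans hs.1, hs.2⟩,
    matInt_congr ht.2 (F' := fun s => -(-((c.closedLoop P s)ᵀ * c.value T P s
      + c.value T P s * c.closedLoop P s
      + ((output (c.Upsilon P) s)ᵀ * c.kernel s s * output (c.Upsilon P) s - c.drift T P s))))
      fun s hs => by rw [neg_neg, ← h s ⟨ht.1.trans hs.1, hs.2⟩],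
    h t ht, hv.eq t ht, value_right h1 h2 h4 hP hT, sub_eq_add_neg, ← intervalIntegral.integral_neg]
  exact congrArg (c.G T + ·)
    (matInt_eq (intervalIntegrable_sub hv.integrable ht hTm).neg).symm

omit hP in
-- With the feedback of `P` held fixed, `P` and `value` solve the same linear Lyapunov equation with
-- terminal value `G(T)`. Their difference solves the homogeneous equation, whose kernel is at most
-- `2 ‖a‖`, and so vanishes.
lemma eq_value_of_isRiccatiSolution (hR : IsRiccatiSolution T c P) :
    ∀ t ∈ Icc 0 T, P t = c.value T P t := by
  have hP : ContinuousOn P (Icc 0 T) := hR.cont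
  obtain ⟨Φ, hΦ, heq⟩ := hR.eqn
  have ha := integrableOn_closedLoop h1 h2 h4 hP
  have hv := value_isPrimitive h1 h2 h4 hP hT h3
  have hTm : T ∈ Icc 0 T := right_mem_Icc.2 hT.le
  have hlyap : ∀ {J : ℝ → Matrix (Fin n) (Fin n) ℝ}, ContinuousOn J (Icc 0 T) →
      IntegrableOn (fun s => (c.closedLoop P s)ᵀ * J s + J s * c.closedLoop P s) (Icc 0 T) := by
    intro J hJ
    have hJ' := memLp_top_of_continuousOn (ν := volume) isCompact_Icc hJ
    have ha' := memLp_one_iff_integrable.2 ha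
    exact (memLp_one_iff_integrable.1 (ha'.mtranspose.mmul (R := 1) hJ')).add
      (memLp_one_iff_integrable.1 (hJ'.mmul (R := 1) ha'))
  -- Integrability of the inhomogeneity is read off the equation for `value`: it is the integrable
  -- derivative, up to sign, minus the Lyapunov terms.
  have hD : IntegrableOn (fun s => (output (c.Upsilon P) s)ᵀ * c.kernel s s
      * output (c.Upsilon P) s - c.drift T P s) (Icc 0 T) := by
    refine ((hv.integrable.neg).sub (hlyap hv.continuousOn)).congr_fun (fun s _ => ?_)
      measurableSet_Icc
    simp
  have hPp : IsPrimitive 0 T P (fun s => -((c.closedLoop P s)ᵀ * P s + P s * c.closedLoop P s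
      + ((output (c.Upsilon P) s)ᵀ * c.kernel s s * output (c.Upsilon P) s
        - c.drift T P s))) := by
    have hint := (hlyap hP).add hD
    refine ⟨hint.neg, fun t ht => ?_⟩
    have hPT : P T = c.G T := by
      rw [heq T hTm]
      ext i j
      simp [matInt]
    rw [hPT, intervalIntegral.integral_neg, sub_neg_eq_add, heq t ht,
      matInt_congr ht.2 fun s hs => riccati_integrand_eq h1 h2 h4 hP hT h3 hΦ
        ⟨ht.1.trans hs.1, hs.2⟩]
    exact congrArg (c.G T + ·) (matInt_eq (intervalIntegrable_sub hint ht hTm))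
  intro t ht
  refine sub_eq_zero.1 ((hPp.sub hv).eq_zero (k := fun s => 2 * ‖c.closedLoop P s‖)
    (ha.norm.const_mul 2) (fun s => by positivity) (fun s _ => ?_) ?_ ht)
  · have e : ∀ X Y D : Matrix (Fin n) (Fin n) ℝ, ∀ a : Matrix (Fin n) (Fin n) ℝ,
        -(aᵀ * X + X * a + D) - -(aᵀ * Y + Y * a + D)
          = -(aᵀ * (X - Y) + (X - Y) * a) := by
      intro X Y D a
      noncomm_ring
    rw [e, norm_neg]
    refine (norm_add_le _ _).trans ?_
    have i1 := Matrix.frobenius_norm_mul (c.closedLoop P s)ᵀ (P s - c.value T P s)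
    have i2 := Matrix.frobenius_norm_mul (P s - c.value T P s) (c.closedLoop P s)
    rw [Matrix.frobenius_norm_transpose] at i1
    linarith
  · rw [value_right h1 h2 h4 hP hT, heq T hTm]
    ext i j
    simp [matInt]

end

end Coeffs

/-! ### Traces and norms -/

section Trace

variable {p q : Type*} [Fintype p] [Fintype q]

lemma abs_entry_le_norm (A : Matrix p q ℝ) (i : p) (j : q) : |A i j| ≤ ‖A‖ := by
  refine abs_le_of_sq_le_sq ?_ (norm_nonneg _)
  rw [frobenius_norm_sq]
  calc A i j ^ 2 ≤ ∑ l, A i l ^ 2 :=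
        Finset.single_le_sum (f := fun l => A i l ^ 2) (fun _ _ => sq_nonneg _) (Finset.mem_univ j)
    _ ≤ _ := Finset.single_le_sum (f := fun k => ∑ l, A k l ^ 2)
        (fun _ _ => Finset.sum_nonneg fun _ _ => sq_nonneg _) (Finset.mem_univ i)

lemma abs_trace_le (A : Matrix p p ℝ) : |A.trace| ≤ Fintype.card p * ‖A‖ := by
  calc |A.trace| ≤ ∑ i, |A i i| := Finset.abs_sum_le_sum_abs _ _
    _ ≤ ∑ _i : p, ‖A‖ := Finset.sum_le_sum fun i _ => abs_entry_le_norm A i i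
    _ = _ := by simp

/-- With `A = Cᵀ C`, `‖A‖ ≤ ‖C‖² = tr A`. This lets a scalar inequality for the trace control the
matrix. -/
lemma norm_le_trace {A : Matrix p p ℝ} (hA : A.PosSemidef) : ‖A‖ ≤ A.trace := by
  obtain ⟨C, rfl⟩ := exists_eq_transpose_mul_self hA
  refine (Matrix.frobenius_norm_mul _ _).trans (le_of_eq ?_)
  rw [Matrix.frobenius_norm_transpose, ← sq, frobenius_norm_sq, Finset.sum_comm, Matrix.trace]
  simp [Matrix.mul_apply, sq]

/-- The trace of the closed-loop Riccati operator when the feedback uses a scaled-down `ρ P`: the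
quadratic term only helps. -/
lemma trace_closedLoop_le {n m : ℕ} {A P Q : Matrix (Fin n) (Fin n) ℝ}
    {B : Matrix (Fin n) (Fin m) ℝ} {S U : Matrix (Fin m) (Fin n) ℝ}
    {M N : Matrix (Fin m) (Fin m) ℝ} (hP : P.PosSemidef) (hN : N.PosSemidef) (hMN : M * N = 1)
    {ρ : ℝ} (hρ0 : 0 ≤ ρ) (hρ1 : ρ ≤ 1) (hU : U = N * (Bᵀ * (ρ • P) + S)) :
    ((A - B * U)ᵀ * P + P * (A - B * U) + (Q + (Uᵀ * M * U - Uᵀ * S - Sᵀ * U))).trace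
      ≤ Q.trace + 2 * n * (‖A‖ + ‖S‖ * ‖N‖ * ‖B‖) * P.trace := by
  have hPs := transpose_eq_of_posSemidef hP
  have hNs := transpose_eq_of_posSemidef hN
  set W := Bᵀ * P with hW
  have hWt : Wᵀ = P * B := by rw [hW, Matrix.transpose_mul, Matrix.transpose_transpose, hPs]
  have hMU : M * U = ρ • W + S := by
    rw [hU, ← Matrix.mul_assoc, hMN, Matrix.one_mul, Matrix.mul_smul]
  have hU' : U = ρ • (N * W) + N * S := by
    rw [hU, Matrix.mul_add, Matrix.mul_smul, Matrix.mul_smul]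
  have tr_sym : ∀ X Y : Matrix (Fin m) (Fin n) ℝ, (Xᵀ * Y).trace = (Yᵀ * X).trace := by
    intro X Y
    rw [← Matrix.trace_transpose, Matrix.transpose_mul, Matrix.transpose_transpose]
  set y := (Sᵀ * (N * W)).trace with hy
  have hy' : (Wᵀ * (N * S)).trace = y := by
    rw [tr_sym, Matrix.transpose_mul, hNs, Matrix.mul_assoc]
  have hWU : (Wᵀ * U).trace = ρ * (Wᵀ * (N * W)).trace + y := by
    rw [hU', Matrix.mul_add, Matrix.trace_add, Matrix.mul_smul, Matrix.trace_smul, hy', smul_eq_mul]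
  have hSU : (Sᵀ * U).trace = ρ * y + (Sᵀ * (N * S)).trace := by
    rw [hU', Matrix.mul_add, Matrix.trace_add, Matrix.mul_smul, Matrix.trace_smul, smul_eq_mul]
  have t1 : (P * (A - B * U)).trace = (P * A).trace - (Wᵀ * U).trace := by
    rw [Matrix.mul_sub, Matrix.trace_sub, hWt, Matrix.mul_assoc]
  have t2 : ((A - B * U)ᵀ * P).trace = (P * A).trace - (Wᵀ * U).trace := by
    rw [← t1, ← Matrix.trace_transpose, Matrix.transpose_mul, Matrix.transpose_transpose, hPs]
  have t3 : (Uᵀ * M * U).trace = ρ * (Wᵀ * U).trace + (Sᵀ * U).trace := by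
    rw [Matrix.mul_assoc, hMU, Matrix.mul_add, Matrix.trace_add, Matrix.mul_smul,
      Matrix.trace_smul, tr_sym U W, tr_sym U S, smul_eq_mul]
  have p1 : 0 ≤ (Wᵀ * (N * W)).trace := by
    rw [← Matrix.mul_assoc]; exact (posSemidef_sandwich hN W).trace_nonneg
  have p2 : 0 ≤ (Sᵀ * (N * S)).trace := by
    rw [← Matrix.mul_assoc]; exact (posSemidef_sandwich hN S).trace_nonneg
  have hPtr := norm_le_trace hP
  have b1 : (P * A).trace ≤ n * (‖A‖ * P.trace) := by
    refine (le_abs_self _).trans ((abs_trace_le _).trans ?_)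
    rw [Fintype.card_fin]
    gcongr
    refine (Matrix.frobenius_norm_mul _ _).trans ?_
    rw [mul_comm]
    gcongr
  have b2 : -y ≤ n * (‖S‖ * ‖N‖ * ‖B‖ * P.trace) := by
    refine (neg_le_abs _).trans ((abs_trace_le _).trans ?_)
    rw [Fintype.card_fin]
    gcongr
    calc ‖Sᵀ * (N * W)‖ ≤ ‖S‖ * (‖N‖ * (‖B‖ * ‖P‖)) := by
          refine (Matrix.frobenius_norm_mul _ _).trans ?_
          rw [Matrix.frobenius_norm_transpose]
          gcongr
          refine (Matrix.frobenius_norm_mul _ _).trans ?_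
          gcongr
          refine (Matrix.frobenius_norm_mul _ _).trans ?_
          rw [Matrix.frobenius_norm_transpose]
      _ = ‖S‖ * ‖N‖ * ‖B‖ * ‖P‖ := by ring
      _ ≤ _ := by gcongr
  simp only [Matrix.trace_add, Matrix.trace_sub, t1, t2, t3, tr_sym U S]
  -- The terms involving `U` add up to `-ρ(2-ρ) tr(WᵀNW) - 2y - tr(SᵀNS)`. The cross terms `-(2-ρ)y
  -- - ρy` combine to `-2y`, free of `ρ`, so only `-2y` needs an estimate.
  have p3 : 0 ≤ ρ * (2 - ρ) * (Wᵀ * (N * W)).trace :=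
    mul_nonneg (mul_nonneg hρ0 (by linarith)) p1
  rw [hWU, hSU]
  nlinarith

end Trace

/-! ### Lipschitz and a priori estimates for the value. -/

namespace Coeffs

variable {n m : ℕ} {c : Coeffs n m} {T : ℝ}

lemma exists_bounds (h1 : H1 T c) (h2 : H2 T c) (h4 : H4 T c) :
    ∃ ν σ b : ℝ, 0 ≤ ν ∧ 0 ≤ σ ∧ 0 ≤ b ∧ ∀ᵐ s ∂volume.restrict (Icc 0 T),
      ‖(c.M s s)⁻¹‖ ≤ ν ∧ ‖c.S s s‖ ≤ σ ∧ ‖c.B s‖ ≤ b := by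
  obtain ⟨ν, hν0, hν⟩ := memLp_top_bound
    (memLp_top_of_continuousOn (ν := volume) isCompact_Icc (continuousOn_inv h2))
  obtain ⟨σ, hσ0, hσ⟩ := memLp_top_bound
    (memLp_top_of_continuousOn (ν := volume) isCompact_Icc h4.S_C1.continuousOn_diag)
  obtain ⟨b, hb0, hb⟩ := memLp_top_bound (memLp_B h1)
  refine ⟨ν, σ, b, hν0, hσ0, hb0, ?_⟩
  filter_upwards [hν, hσ, hb] with s x y z using ⟨x, y, z⟩

/-- On bounded sets, the value depends on `P` in a causal and Lipschitz way. -/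
lemma exists_value_lipschitz (hT : 0 < T) (h1 : H1 T c) (h2 : H2 T c) (h3 : H3 T c) (h4 : H4 T c)
    {R : ℝ} (hR : 0 ≤ R) :
    ∃ C, 0 ≤ C ∧ ∀ P P' : ℝ → Matrix (Fin n) (Fin n) ℝ, ContinuousOn P (Icc 0 T) →
      ContinuousOn P' (Icc 0 T) → (∀ t ∈ Icc 0 T, ‖P t‖ ≤ R) → (∀ t ∈ Icc 0 T, ‖P' t‖ ≤ R) →
      ∀ t ∈ Icc 0 T, ‖c.value T P t - c.value T P' t‖ ≤ C * ∫ s in t..T, ‖P s - P' s‖ := by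
  obtain ⟨ν, σ, b, hν0, hσ0, hb0, hbd⟩ := exists_bounds h1 h2 h4
  have hA := integrableOn_A h1
  have h0 : (0 : ℝ) ∈ Icc 0 T := left_mem_Icc.2 hT.le
  have hTm : T ∈ Icc 0 T := right_mem_Icc.2 hT.le
  -- `u` bounds the gain `Υ` a.e. whenever `‖P‖ ≤ R`; the integral of `‖A‖ + b u` then bounds the
  -- `L¹` norm of every such closed loop.
  set u := ν * (b * R + σ) with hu
  have hu0 : 0 ≤ u := by positivity
  obtain ⟨C, hC0, hC⟩ := exists_cost_lipschitz hT.le (kernel_isC1Kernel hT h2 h3 h4).cont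
    (h3.G_C1.isPrimitive hT).continuousOn (∫ s in 0..T, (‖c.A s‖ + b * u))
    (‖(1 : Matrix (Fin n) (Fin n) ℝ)‖ + u) b (by positivity) hb0
  have hUb : ∀ P : ℝ → Matrix (Fin n) (Fin n) ℝ, (∀ t ∈ Icc 0 T, ‖P t‖ ≤ R) →
      ∀ᵐ s ∂volume.restrict (Icc 0 T), ‖c.Upsilon P s‖ ≤ u := by
    intro P hP
    filter_upwards [hbd, ae_restrict_mem measurableSet_Icc] with s ⟨x, y, z⟩ hs
    refine (Matrix.frobenius_norm_mul _ _).trans (mul_le_mul x ?_ (norm_nonneg _) hν0)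
    refine (norm_add_le _ _).trans (add_le_add ?_ y)
    refine (Matrix.frobenius_norm_mul _ _).trans ?_
    rw [Matrix.frobenius_norm_transpose]
    exact mul_le_mul z (hP s hs) (norm_nonneg _) hb0
  have haL : ∀ P : ℝ → Matrix (Fin n) (Fin n) ℝ, ContinuousOn P (Icc 0 T) →
      (∀ t ∈ Icc 0 T, ‖P t‖ ≤ R) →
      ∫ s in 0..T, ‖c.closedLoop P s‖ ≤ ∫ s in 0..T, (‖c.A s‖ + b * u) := by
    intro P hPc hP
    refine integral_le_of_ae (integrableOn_closedLoop h1 h2 h4 hPc).norm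
      (hA.norm.add (integrableOn_const (by simp))) h0 ?_
    filter_upwards [hbd, hUb P hP] with s ⟨x, y, z⟩ hs _
    refine (norm_sub_le _ _).trans (add_le_add le_rfl ?_)
    exact (Matrix.frobenius_norm_mul _ _).trans (mul_le_mul z hs (norm_nonneg _) hb0)
  have hVb : ∀ P : ℝ → Matrix (Fin n) (Fin n) ℝ, (∀ t ∈ Icc 0 T, ‖P t‖ ≤ R) →
      ∀ᵐ s ∂volume.restrict (Icc 0 T),
        ‖output (c.Upsilon P) s‖ ≤ ‖(1 : Matrix (Fin n) (Fin n) ℝ)‖ + u := by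
    intro P hP
    filter_upwards [hUb P hP] with s hs
    exact (norm_output_le _ s).trans (add_le_add le_rfl hs)
  refine ⟨C * (ν * b), by positivity, fun P P' hPc hPc' hP hP' t ht => ?_⟩
  have hUd : ∀ᵐ s ∂volume.restrict (Icc 0 T),
      ‖c.Upsilon P s - c.Upsilon P' s‖ ≤ ν * b * ‖P s - P' s‖ := by
    filter_upwards [hbd] with s ⟨x, y, z⟩
    have e : c.Upsilon P s - c.Upsilon P' s = (c.M s s)⁻¹ * ((c.B s)ᵀ * (P s - P' s)) := by
      simp only [Upsilon, Matrix.mul_add, Matrix.mul_sub]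
      abel
    rw [e, mul_assoc]
    refine (Matrix.frobenius_norm_mul _ _).trans (mul_le_mul x ?_ (norm_nonneg _) hν0)
    refine (Matrix.frobenius_norm_mul _ _).trans ?_
    rw [Matrix.frobenius_norm_transpose]
    exact mul_le_mul_of_nonneg_right z (norm_nonneg _)
  have hδ : IntegrableOn (fun s => ν * b * ‖P s - P' s‖) (Icc 0 T) :=
    ((hPc.sub hPc').norm.integrableOn_compact isCompact_Icc).const_mul _
  have h := hC (c.closedLoop P) (c.closedLoop P') (output (c.Upsilon P)) (output (c.Upsilon P'))
    (fun s => ν * b * ‖P s - P' s‖) (integrableOn_closedLoop h1 h2 h4 hPc)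
    (integrableOn_closedLoop h1 h2 h4 hPc') (haL P hPc hP) (haL P' hPc' hP')
    (memLp_outputMap (memLp_Upsilon h1 h2 h4 hPc)) (memLp_outputMap (memLp_Upsilon h1 h2 h4 hPc'))
    (hVb P hP) (hVb P' hP') hδ (fun s => by positivity)
    (by
      filter_upwards [hUd, hbd] with s hs ⟨x, y, z⟩
      have e : c.closedLoop P s - c.closedLoop P' s
          = -(c.B s * (c.Upsilon P s - c.Upsilon P' s)) := by
        simp only [closedLoop, Matrix.mul_sub]
        abel
      rw [e, norm_neg]
      exact (Matrix.frobenius_norm_mul _ _).trans (mul_le_mul z hs (norm_nonneg _) hb0))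
    (by
      filter_upwards [hUd] with s hs
      rwa [norm_output_sub]) t ht
  refine h.trans (le_of_eq ?_)
  rw [intervalIntegral.integral_const_mul]
  ring

lemma value_posSemidef (h2 : H2 T c) (h3 : H3 T c) (h5 : H5 T c)
    {P : ℝ → Matrix (Fin n) (Fin n) ℝ} {t : ℝ} (ht : t ∈ Icc 0 T) :
    (c.value T P t).PosSemidef :=
  cost_posSemidef ht.2 (h3.G_nonneg t ht) fun _ hs => kernel_posSemidef h2 h5 ht.1 hs.1 hs.2

lemma drift_posSemidef (h5 : H5 T c) {P : ℝ → Matrix (Fin n) (Fin n) ℝ} {t : ℝ}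
    (ht : t ∈ Icc 0 T) : (c.drift T P t).PosSemidef :=
  cost_posSemidef ht.2 (h5.G_dot_nonneg t ht) fun _ hs =>
    kernelDeriv_posSemidef h5 ht.1 hs.1 hs.2

/-- A priori bound, uniform in the scaling `ρ`. -/
lemma exists_apriori_bound (hT : 0 < T) (h1 : H1 T c) (h2 : H2 T c) (h3 : H3 T c) (h4 : H4 T c)
    (h5 : H5 T c) :
    ∃ R : ℝ, 0 < R ∧ ∀ (P : ℝ → Matrix (Fin n) (Fin n) ℝ) (ρ : ℝ → ℝ),
      ContinuousOn (fun s => ρ s • P s) (Icc 0 T) → (∀ s, 0 ≤ ρ s) → (∀ s, ρ s ≤ 1) →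
      (∀ t ∈ Icc 0 T, P t = c.value T (fun s => ρ s • P s) t) → ∀ t ∈ Icc 0 T, ‖P t‖ ≤ R := by
  obtain ⟨ν, σ, b, hν0, hσ0, hb0, hbd⟩ := exists_bounds h1 h2 h4
  have hA := integrableOn_A h1
  have h0 : (0 : ℝ) ∈ Icc 0 T := left_mem_Icc.2 hT.le
  have hTm : T ∈ Icc 0 T := right_mem_Icc.2 hT.le
  obtain ⟨q, hq⟩ := isCompact_Icc.exists_bound_of_continuousOn
    (traceCLM.continuous.comp_continuousOn h3.Q_C1.continuousOn_diag)
  have hq0 : 0 ≤ q := (norm_nonneg _).trans (hq 0 h0)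
  set k : ℝ → ℝ := fun s => 2 * n * (‖c.A s‖ + σ * ν * b) with hk
  have hk0 : ∀ s, 0 ≤ k s := fun s => by positivity
  have hki : IntegrableOn k (Icc 0 T) :=
    (hA.norm.add (integrableOn_const (by simp))).const_mul _
  set c₀ := (c.G T).trace + q * T with hc₀
  have hc₀0 : 0 ≤ c₀ := add_nonneg (h3.G_nonneg T hTm).trace_nonneg (by positivity)
  -- The Gronwall bound for the trace; the summand 1 only makes the radius strictly positive.
  refine ⟨2 * c₀ * Real.exp (2 * ∫ s in 0..T, k s) + 1, by positivity, ?_⟩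
  intro P ρ hPc hρ0 hρ1 hfix t ht
  set P' : ℝ → Matrix (Fin n) (Fin n) ℝ := fun s => ρ s • P s with hP'
  have hpsd : ∀ s ∈ Icc 0 T, (P s).PosSemidef := fun s hs => by
    rw [hfix s hs]; exact value_posSemidef h2 h3 h5 hs
  have hv := value_isPrimitive h1 h2 h4 hPc hT h3
  have hvt := hv.clm traceCLM
  have hwc : ContinuousOn (fun s => (P s).trace) (Icc 0 T) :=
    hvt.continuousOn.congr fun s hs => by simp [hfix s hs]
  have hkw := integrableOn_mul_continuousOn hki hwc
  have hineq : ∀ s ∈ Icc 0 T, (P s).trace ≤ c₀ + ∫ r in s..T, k r * (P r).trace := by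
    intro s hs
    have e := hvt.eq s hs
    simp only [traceCLM_apply, map_neg, intervalIntegral.integral_neg, sub_neg_eq_add] at e
    rw [hfix s hs, e, value_right h1 h2 h4 hPc hT, hc₀, add_assoc]
    gcongr
    have hint := hvt.integrable.neg
    calc _ ≤ ∫ r in s..T, (q + k r * (P r).trace) := by
          refine integral_le_of_ae ?_ ((integrableOn_const (by simp)).add hkw) hs ?_
          · refine hint.congr_fun (fun r _ => ?_) measurableSet_Icc
            simp [-neg_add_rev]
          filter_upwards [hbd, ae_restrict_mem measurableSet_Icc] with r ⟨x, y, z⟩ hr _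
          have hM := h2.M_pos r hr r hr
          have hMN : c.M r r * (c.M r r)⁻¹ = 1 :=
            Matrix.mul_nonsing_inv _ hM.det_pos.ne'.isUnit
          have htr := trace_closedLoop_le (A := c.A r) (Q := c.Q r r) (hpsd r hr)
            hM.inv.posSemidef hMN (hρ0 r) (hρ1 r) (B := c.B r) (S := c.S r r)
            (U := c.Upsilon P' r) rfl
          -- The drift enters with a minus sign, so its nonnegative trace can be dropped.
          have hd := (drift_posSemidef h5 (P := P') hr).trace_nonneg
          have hQ := (le_abs_self _).trans (hq r hr)
          have hPn := (hpsd r hr).trace_nonneg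
          rw [kernel, output_sandwich, ← hfix r hr, closedLoop, ← add_sub_assoc,
            Matrix.trace_sub]
          have hle : 2 * (n : ℝ) * (‖c.A r‖ + ‖c.S r r‖ * ‖(c.M r r)⁻¹‖ * ‖c.B r‖) * (P r).trace
              ≤ k r * (P r).trace := by
            simp only [hk]
            gcongr
          simp only [Function.comp, traceCLM_apply] at hQ
          linarith
      _ = q * (T - s) + ∫ r in s..T, k r * (P r).trace := by
          rw [intervalIntegral.integral_add intervalIntegrable_const
            (intervalIntegrable_sub hkw hs hTm), intervalIntegral.integral_const, smul_eq_mul,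
            mul_comm]
      _ ≤ q * T + ∫ r in s..T, k r * (P r).trace := by
          have := hs.1
          gcongr
          linarith
  have hg := gronwall_backward hki hk0 hwc hc₀0 hineq ht
  refine (norm_le_trace (hpsd t ht)).trans (hg.trans ?_)
  have := tail_antitone hki hk0 h0 ht ht.1
  have h2' : 2 * c₀ * Real.exp (2 * ∫ r in t..T, k r)
      ≤ 2 * c₀ * Real.exp (2 * ∫ r in 0..T, k r) := by gcongr
  linarith

end Coeffs

/-! ### Radial truncation -/

section Truncation

variable {E : Type*} [NormedAddCommGroup E] [NormedSpace ℝ E] {R : ℝ}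

/-- The radial retraction onto the ball of radius `R`. -/
def truncate (R : ℝ) (x : E) : E := (R / max R ‖x‖) • x

lemma norm_truncate_le (hR : 0 < R) (x : E) : ‖truncate R x‖ ≤ R := by
  have hm : 0 < max R ‖x‖ := lt_max_of_lt_left hR
  rw [truncate, norm_smul, Real.norm_of_nonneg (by positivity), div_mul_eq_mul_div,
    div_le_iff₀ hm]
  exact mul_le_mul_of_nonneg_left (le_max_right _ _) hR.le

lemma truncate_of_norm_le (hR : 0 < R) {x : E} (hx : ‖x‖ ≤ R) : truncate R x = x := by
  rw [truncate, max_eq_left hx, div_self hR.ne', one_smul]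

/-- Changing the vector and changing the scaling factor each cost at most `‖x - y‖`; the argument
works in any normed space. -/
lemma norm_truncate_sub_le (hR : 0 < R) (x y : E) :
    ‖truncate R x - truncate R y‖ ≤ 2 * ‖x - y‖ := by
  have hx : 0 < max R ‖x‖ := lt_max_of_lt_left hR
  have hy : 0 < max R ‖y‖ := lt_max_of_lt_left hR
  have e : truncate R x - truncate R y
      = (R / max R ‖x‖) • (x - y) + (R / max R ‖x‖ - R / max R ‖y‖) • y := by
    simp only [truncate, smul_sub, sub_smul]
    abel
  rw [e]
  refine (norm_add_le _ _).trans ?_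
  rw [norm_smul, norm_smul, Real.norm_of_nonneg (by positivity), two_mul]
  refine add_le_add (mul_le_of_le_one_left (norm_nonneg _)
    ((div_le_one hx).2 (le_max_left _ _))) ?_
  have h1 : |max R ‖x‖ - max R ‖y‖| ≤ ‖x - y‖ := by
    refine (abs_max_sub_max_le_max _ _ _ _).trans ?_
    simp only [sub_self, abs_zero]
    exact max_le (norm_nonneg _) (abs_norm_sub_norm_le _ _)
  have h2 : R / max R ‖x‖ - R / max R ‖y‖
      = -(R * (max R ‖x‖ - max R ‖y‖)) / (max R ‖x‖ * max R ‖y‖) := by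
    field_simp
    ring
  rw [h2, Real.norm_eq_abs, abs_div, abs_neg, abs_mul, abs_of_pos hR,
    abs_of_pos (mul_pos hx hy), div_mul_eq_mul_div, div_le_iff₀ (mul_pos hx hy)]
  calc R * |max R ‖x‖ - max R ‖y‖| * ‖y‖ ≤ max R ‖x‖ * ‖x - y‖ * max R ‖y‖ := by
        gcongr
        · exact le_max_left _ _
        · exact le_max_right _ _
    _ = ‖x - y‖ * (max R ‖x‖ * max R ‖y‖) := by ring

lemma continuous_truncate (hR : 0 < R) : Continuous (truncate R : E → E) :=
  (LipschitzWith.of_dist_le_mul (K := 2) fun x y => by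
    simpa [dist_eq_norm] using norm_truncate_sub_le hR x y).continuous

end Truncation

/-! ### Existence and uniqueness of the fixed point. -/

namespace Coeffs

variable {n m : ℕ} {c : Coeffs n m} {T : ℝ}

/-- The truncation radius is the a priori bound itself, which holds for truncated fixed points too;
the truncation therefore acts as the identity on the fixed point found. -/
lemma exists_eq_value (hT : 0 < T) (h1 : H1 T c) (h2 : H2 T c) (h3 : H3 T c) (h4 : H4 T c)
    (h5 : H5 T c) :
    ∃ P : ℝ → Matrix (Fin n) (Fin n) ℝ, ContinuousOn P (Icc 0 T) ∧
      ∀ t ∈ Icc 0 T, P t = c.value T P t := by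
  obtain ⟨R, hR, hbound⟩ := exists_apriori_bound hT h1 h2 h3 h4 h5
  obtain ⟨C, hC0, hC⟩ := exists_value_lipschitz hT h1 h2 h3 h4 hR.le
  have hTm : T ∈ Icc 0 T := right_mem_Icc.2 hT.le
  have htc : ∀ {u : ℝ → Matrix (Fin n) (Fin n) ℝ}, ContinuousOn u (Icc 0 T) →
      ContinuousOn (fun s => truncate R (u s)) (Icc 0 T) := fun hu =>
    (continuous_truncate hR).comp_continuousOn hu
  obtain ⟨P, hPc, hP⟩ := exists_fixedPoint_backward (k := fun _ => C * 2) hT.le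
    (integrableOn_const (by simp)) (fun _ => by positivity)
    (fun (u : ℝ → Matrix (Fin n) (Fin n) ℝ) => c.value T fun s => truncate R (u s))
    (fun u hu => (value_isPrimitive h1 h2 h4 (htc hu) hT h3).continuousOn)
    (fun u v hu hv t ht => by
      refine (hC _ _ (htc hu) (htc hv) (fun s _ => norm_truncate_le hR _)
        (fun s _ => norm_truncate_le hR _) t ht).trans ?_
      rw [← intervalIntegral.integral_const_mul]
      refine intervalIntegral.integral_mono_on ht.2
        (intervalIntegrable_sub ((((htc hu).sub (htc hv)).norm.integrableOn_compact
          isCompact_Icc).const_mul C) ht hTm)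
        (intervalIntegrable_sub (((hu.sub hv).norm.integrableOn_compact
          isCompact_Icc).const_mul (C * 2)) ht hTm) fun s _ => ?_
      rw [mul_assoc]
      exact mul_le_mul_of_nonneg_left (norm_truncate_sub_le hR _ _) hC0)
  -- Truncation is scaling by `ρ = R / max R ‖P‖`, which lies in `[0,1]`.
  have hle := hbound P (fun s => R / max R ‖P s‖) (htc hPc) (fun s => by positivity)
    (fun s => (div_le_one (lt_max_of_lt_left hR)).2 (le_max_left _ _)) hP
  refine ⟨P, hPc, fun t ht => (hP t ht).trans (sub_eq_zero.1 (norm_le_zero_iff.1 ?_))⟩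
  -- `P` and its truncation are known to agree only on `[0,T]`; the Lipschitz estimate with zero
  -- integrand transfers this to their values.
  refine (hC _ _ (htc hPc) hPc (fun s _ => norm_truncate_le hR _) hle t ht).trans (le_of_eq ?_)
  rw [intervalIntegral.integral_congr (g := fun _ => (0 : ℝ)), intervalIntegral.integral_zero,
    mul_zero]
  intro s hs
  rw [uIcc_of_le ht.2] at hs
  simp only [truncate_of_norm_le hR (hle s ⟨ht.1.trans hs.1, hs.2⟩), sub_self, norm_zero]

/-- Continuity on a compact interval already bounds both solutions, so the Lipschitz estimate
applies with a common radius and Gronwall with constant 0 concludes; no positivity is involved. -/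
lemma eqOn_of_eq_value (hT : 0 < T) (h1 : H1 T c) (h2 : H2 T c) (h3 : H3 T c) (h4 : H4 T c)
    {P P' : ℝ → Matrix (Fin n) (Fin n) ℝ} (hPc : ContinuousOn P (Icc 0 T))
    (hPc' : ContinuousOn P' (Icc 0 T)) (hP : ∀ t ∈ Icc 0 T, P t = c.value T P t)
    (hP' : ∀ t ∈ Icc 0 T, P' t = c.value T P' t) : EqOn P P' (Icc 0 T) := by
  obtain ⟨r, hr⟩ := isCompact_Icc.exists_bound_of_continuousOn hPc
  obtain ⟨r', hr'⟩ := isCompact_Icc.exists_bound_of_continuousOn hPc'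
  have hr0 : 0 ≤ max r r' :=
    ((norm_nonneg _).trans (hr 0 (left_mem_Icc.2 hT.le))).trans (le_max_left _ _)
  obtain ⟨C, hC0, hC⟩ := exists_value_lipschitz hT h1 h2 h3 h4 hr0
  intro t ht
  have hg := gronwall_backward (k := fun _ => C) (w := fun s => ‖P s - P' s‖) (a := 0) (b := T)
    (integrableOn_const (by simp)) (fun _ => hC0) (hPc.sub hPc').norm le_rfl
    (fun s hs => by
      have := hC P P' hPc hPc' (fun x hx => (hr x hx).trans (le_max_left _ _))
        (fun x hx => (hr' x hx).trans (le_max_right _ _)) s hs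
      rwa [← hP s hs, ← hP' s hs, ← intervalIntegral.integral_const_mul, ← zero_add (∫ _ in _.._, _)]
        at this) ht
  exact sub_eq_zero.1 (norm_le_zero_iff.1 (by simpa using hg))

end Coeffs

end EqRiccati

open EqRiccati EqRiccati.Coeffs in
theorem mainTheorem2 {n m : ℕ} (T : ℝ) (hT : 0 < T) (c : EqRiccati.Coeffs n m)
    (h1 : EqRiccati.H1 T c) (h2 : EqRiccati.H2 T c) (h3 : EqRiccati.H3 T c)
    (h4 : EqRiccati.H4 T c) (h5 : EqRiccati.H5 T c) :
    ∃ P : ℝ → Matrix (Fin n) (Fin n) ℝ,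
      EqRiccati.IsRiccatiSolution T c P ∧
      (∀ P' : ℝ → Matrix (Fin n) (Fin n) ℝ, EqRiccati.IsRiccatiSolution T c P' →
        Set.EqOn P' P (Set.Icc 0 T)) ∧
      ∀ t ∈ Set.Icc 0 T, (P t).PosSemidef := by
  obtain ⟨P, hPc, hP⟩ := exists_eq_value hT h1 h2 h3 h4 h5
  have hpsd : ∀ t ∈ Set.Icc 0 T, (P t).PosSemidef := fun t ht => by
    rw [hP t ht]
    exact value_posSemidef h2 h3 h5 ht
  refine ⟨P, isRiccatiSolution_of_eq_value h1 h2 h4 hPc hT h3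
    (fun t ht => transpose_eq_of_posSemidef (hpsd t ht)) hP, fun P' hP' => ?_, hpsd⟩
  exact eqOn_of_eq_value hT h1 h2 h3 h4 hP'.cont hPc
    (eq_value_of_isRiccatiSolution h1 h2 h4 hT h3 hP') hP

end
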